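/- There exist universal constants $C_1, C_2 > 0$ (independent of all the parameters below, in particular of $n$ and $p$) such that the following holds. Let $n \ge 1$, and let $K \subset \mathbb{R}^n$ be a centrally symmetric convex body (compact, convex, with non-empty interior, $K = -K$) in isotropic position, i.e. $\int_K \langle x,\theta\rangle^2\,dx$ is constant in $\theta \in S^{n-1}$. Let $D$ be the Euclidean ball centred at the origin with $\mathrm{Vol}(D) = \mathrm{Vol}(K)$. Then for every real $p > 0$ and every $L \in SL_p^n$, $$\frac{C_1}{\sqrt{p_0}} \;\le\; L_K \Big/ \left( \frac{\widetilde V_{-p}(L,K)}{\widetilde V_{-p}(L,D)} \right)^{1/p} \;\le\; C_2 \sqrt{p_0}, \qquad p_0 = \max(1,\min(p,n)).$$ Here: - $L_K \ge 0$ is the isotropic constant of $K$: the number for which $\int_{T(K)} \langle x,\theta\rangle^2\,dx = L_K^2$ for all $\theta\in S^{n-1}$, where $T$ is any invertible linear map such that $T(K)$ has volume $1$ and is in isotropic position. - $SL_p^n$ is the class of unit balls of $n$-dimensional subspaces of $L_p = L_p([0,1],dx)$: the sets $L = \{x \in \mathbb{R}^n : \|Tx\|_{L_p} \le 1\}$ with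 $T : \mathbb{R}^n \to L_p$ linear and injective, where $\|f\|_{L_p} = \left(\int_0^1 |f|^p\right)^{1/p}$ (only a quasi-norm when $p<1$). - For $q \in \mathbb{R}$, $\widetilde V_q(L_1,L_2) = \frac1n \int_{S^{n-1}} \rho_{L_1}(\theta)^q\, \rho_{L_2}(\theta)^{n-q}\,d\theta$ is the dual mixed volume of order $q$, where $\rho_L(\theta) = \max\{r \ge 0 : r\theta \in L\}$ is the radial function and the integration is with respect to the (unnormalised) Lebesgue measure on $S^{n-1}$. -/

import Mathlib

open MeasureTheory Metric

noncomputable section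

namespace DualMixed

/-- `ℝⁿ` with its Euclidean structure. -/
abbrev E (n : ℕ) : Type := EuclideanSpace ℝ (Fin n)

/-- `K` is in isotropic position: `θ ↦ ∫_K ⟨x, θ⟩² dx` is constant on the unit sphere. -/
def IsotropicPosition {n : ℕ} (K : Set (E n)) : Prop :=
  ∃ c : ℝ, ∀ θ ∈ sphere (0 : E n) 1, ∫ x in K, (inner ℝ x θ) ^ 2 = c

/-- `K` has an isotropic position `T(K)` of volume one in which
`∫_{T(K)} ⟨x, θ⟩² dx = ℓ²` for every `θ` in the unit sphere. -/
def HasIsotropicConstant {n : ℕ} (K : Set (E n)) (ℓ : ℝ) : Prop :=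
  0 ≤ ℓ ∧ ∃ T : E n ≃ₗ[ℝ] E n, volume (T '' K) = 1 ∧
    ∀ θ ∈ sphere (0 : E n) 1, ∫ x in T '' K, (inner ℝ x θ) ^ 2 = ℓ ^ 2

/-- The isotropic constant `L_K`: the constant of `K` in its isotropic position of volume one.
By `HasIsotropicConstant.unique` below there is at most one such value when `n ≥ 1`, so the
supremum merely selects it. -/
def isotropicConstant {n : ℕ} (K : Set (E n)) : ℝ :=
  sSup {ℓ : ℝ | HasIsotropicConstant K ℓ}

/-- A set has at most one isotropic constant, so `isotropicConstant` is well defined. -/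
theorem HasIsotropicConstant.unique {n : ℕ} (hn : 1 ≤ n) {K : Set (E n)} {a b : ℝ}
    (ha : HasIsotropicConstant K a) (hb : HasIsotropicConstant K b) : a = b := by
  suffices key : ∀ a b : ℝ, HasIsotropicConstant K a → HasIsotropicConstant K b → a ≤ b from
    le_antisymm (key a b ha hb) (key b a hb ha)
  clear ha hb a b
  rintro a b ⟨ha0, T₁, hv₁, h₁⟩ ⟨hb0, T₂, hv₂, h₂⟩
  set S : E n ≃ₗ[ℝ] E n := T₁.symm.trans T₂ with hS
  have himg : S '' (T₁ '' K) = T₂ '' K := by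
    rw [Set.image_image]
    simp [hS]
  generalize T₁ '' K = A at *
  have hdet : |LinearMap.det (S : E n →ₗ[ℝ] E n)| = 1 := by
    have := Measure.addHaar_image_linearMap (volume : Measure (E n)) (S : E n →ₗ[ℝ] E n) A
    rw [LinearEquiv.coe_coe, himg, hv₁, hv₂, mul_one, eq_comm, ENNReal.ofReal_eq_one] at this
    exact this
  have hmp : MeasurePreserving S (volume : Measure (E n)) volume := by
    refine ⟨S.toContinuousLinearEquiv.continuous.measurable, ?_⟩
    have h0 : LinearMap.det (S : E n →ₗ[ℝ] E n) ≠ 0 := by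
      intro h
      simp [h] at hdet
    have := Measure.map_linearMap_addHaar_eq_smul_addHaar (volume : Measure (E n)) h0
    rw [LinearEquiv.coe_coe, abs_inv, hdet] at this
    simpa using this
  have hemb : MeasurableEmbedding S :=
    S.toContinuousLinearEquiv.toHomeomorph.measurableEmbedding
  set S' : E n →ₗ[ℝ] E n := LinearMap.adjoint (S : E n →ₗ[ℝ] E n) with hS'
  have hq : ∀ φ : E n, ∫ x in A, (inner ℝ x φ) ^ 2 = a ^ 2 * ‖φ‖ ^ 2 := by
    intro φ
    by_cases hφ : φ = 0
    · simp [hφ]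
    have hne : ‖φ‖ ≠ 0 := norm_ne_zero_iff.2 hφ
    have hu := h₁ (‖φ‖⁻¹ • φ) (by simp [norm_smul, hne])
    simp only [inner_smul_right, mul_pow, integral_const_mul] at hu
    rw [← hu]
    field_simp
  have hrel : ∀ θ ∈ sphere (0 : E n) 1, b = a * ‖S' θ‖ := by
    intro θ hθ
    have h := h₂ θ hθ
    rw [← himg, hmp.setIntegral_image_emb hemb] at h
    have h' : ∀ x : E n, inner ℝ (S x) θ = inner ℝ x (S' θ) := by
      intro x
      rw [hS', LinearMap.adjoint_inner_right]
      rfl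
    simp only [h', hq] at h
    rw [← mul_pow] at h
    exact ((pow_left_inj₀ (by positivity) hb0 two_ne_zero).1 h).symm
  have hall : ∀ θ : E n, a * ‖S' θ‖ = b * ‖θ‖ := by
    intro θ
    by_cases hθ : θ = 0
    · simp [hθ]
    have hne : ‖θ‖ ≠ 0 := norm_ne_zero_iff.2 hθ
    have hu := hrel (‖θ‖⁻¹ • θ) (by simp [norm_smul, hne])
    rw [map_smul, norm_smul, norm_inv, norm_norm] at hu
    rw [hu]
    field_simp
  rcases ha0.eq_or_lt with rfl | hapos
  · exact hb0
  have hdet' : |LinearMap.det S'| = 1 := by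
    have e := (EuclideanSpace.basisFun (Fin n) ℝ)
    rw [hS', ← LinearMap.det_toMatrix e.toBasis, LinearMap.toMatrix_adjoint,
      Matrix.det_conjTranspose, LinearMap.det_toMatrix]
    simpa using hdet
  have hsub : S' '' closedBall 0 a ⊆ closedBall 0 b := by
    rintro _ ⟨x, hx, rfl⟩
    rw [mem_closedBall_zero_iff] at hx ⊢
    have := hall x
    have h2 : a * ‖S' x‖ ≤ a * b := by
      rw [this, mul_comm a b]
      exact mul_le_mul_of_nonneg_left hx hb0
    exact le_of_mul_le_mul_left h2 hapos
  have hvol := measure_mono (μ := (volume : Measure (E n))) hsub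
  rw [Measure.addHaar_image_linearMap, hdet', ENNReal.ofReal_one, one_mul,
    Measure.addHaar_closedBall _ _ ha0, Measure.addHaar_closedBall _ _ hb0,
    ENNReal.mul_le_mul_iff_left (measure_ball_pos _ _ one_pos).ne' measure_ball_lt_top.ne,
    ENNReal.ofReal_le_ofReal_iff (by positivity)] at hvol
  have hn' : Module.finrank ℝ (E n) ≠ 0 := by
    simp
    omega
  exact (pow_le_pow_iff_left₀ ha0 hb0 hn').1 hvol

/-- The isotropic constant equals any value that `K` attains in an isotropic position of
volume one. -/
theorem HasIsotropicConstant.isotropicConstant_eq {n : ℕ} (hn : 1 ≤ n) {K : Set (E n)} {ℓ : ℝ}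
    (h : HasIsotropicConstant K ℓ) : isotropicConstant K = ℓ := by
  have : {m : ℝ | HasIsotropicConstant K m} = {ℓ} := by
    ext m
    exact ⟨fun hm => HasIsotropicConstant.unique hn hm h, fun hm => by rw [hm]; exact h⟩
  rw [isotropicConstant, this, csSup_singleton]

/-- The radial function `ρ_L(θ) = max {r ≥ 0 | r θ ∈ L}`. -/
def radial {n : ℕ} (L : Set (E n)) (θ : E n) : ℝ :=
  sSup {r : ℝ | 0 ≤ r ∧ r • θ ∈ L}

/-- The dual mixed volume of order `q`,
`Ṽ_q(L₁, L₂) = (1/n) ∫_{S^{n-1}} ρ_{L₁}^q ρ_{L₂}^{n-q}`, with respect to the (unnormalised)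
Lebesgue measure on the sphere. -/
def dualMixedVolume {n : ℕ} (q : ℝ) (L₁ L₂ : Set (E n)) : ℝ :=
  (1 / (n : ℝ)) * ∫ θ : sphere (0 : E n) 1,
    radial L₁ (θ : E n) ^ q * radial L₂ (θ : E n) ^ ((n : ℝ) - q)
      ∂(volume : Measure (E n)).toSphere

/-- The space `L_p([0,1], dx)`; for `p < 1` the value `‖f‖ = (∫ |f|^p)^{1/p}` is only a
quasi-norm. -/
abbrev LpUnit (p : ℝ) : Type :=
  Lp ℝ (ENNReal.ofReal p) (volume.restrict (Set.Icc (0 : ℝ) 1))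

/-- `SL_p^n`: the unit balls of the `n`-dimensional subspaces of `L_p([0,1])`, where such a
subspace is identified with `ℝⁿ` through an arbitrary linear parametrisation `T`. -/
def SL (p : ℝ) (n : ℕ) : Set (Set (E n)) :=
  {L | ∃ T : E n →ₗ[ℝ] LpUnit p, Function.Injective T ∧ L = {x | ‖T x‖ ≤ 1}}

end DualMixed

end

open DualMixed

open scoped ENNReal NNReal

namespace DualMixed

/-! If `L` is the unit ball of `x ↦ ‖T x‖`, then `ρ_L^{-p}` is `‖T x‖^p` on the sphere, and polar
coordinates give `Ṽ_{-p}(L, K) = (n + p)/n · ∫_K ‖T x‖^p dx` (`dualMixedVolume_eq`). The factor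
cancels in the quotient by the ball `D`. Almost everywhere `T x (t) = ⟨x, w(t)⟩` with `w = symbol
T`, so by Tonelli `∫_K ‖T x‖^p dx` is the integral over `t` of `∫_K |⟨x, w(t)⟩|^p dx`. Bounds for
`∫_K |⟨x, θ⟩|^p dx` that are uniform in the unit vector `θ` therefore pass to `∫_K ‖T x‖^p dx`, with
a factor `∫ |w|^p` that is the same for `K` and `D`. No triangle inequality in `L_p` is needed, so
`p < 1` is not special.

Write `v = Vol(K)^{1/n}` and let `σ²` be the mean of `⟨x, θ⟩²` on `K`; then `L_K = σ/v`. It suffices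
to bound `p`-th means of `|⟨x, θ⟩|`. On `K` they lie between `σ/289` and `16 p₀ σ`; on `D` they lie
between `c √p₀ v` and `√p₀ v`. Dividing gives the theorem, since `p₀/√p₀ = √p₀`.

For `K`, Prékopa–Leindler makes the tail of `|⟨x, θ⟩|` log-concave, hence geometric
(`geometricTail_inner`). Exponential decay gives the upper bound for `1 ≤ p ≤ n`, and the maximum
bound `4nσ` takes over for `p ≥ n`. The lower bound must remain of the form `(const · σ)^p` as `p →
0`. It comes from a small-ball estimate, a bounded moment of order `-1/2`, and Hölder interpolation
through order `0`.

For `D` the means are an explicit quotient of Gamma values, estimated through log-convexity of Gamma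
and a crude Stirling bound. -/

/-! ### Brunn–Minkowski and Prékopa–Leindler inequalities for midpoints. -/

theorem volume_add_volume_le_of_isCompact {A B C : Set ℝ} (hA : IsCompact A) (hB : IsCompact B)
    (hA' : A.Nonempty) (hB' : B.Nonempty) (h : ∀ x ∈ A, ∀ y ∈ B, (2⁻¹ : ℝ) * (x + y) ∈ C) :
    volume A + volume B ≤ 2 * volume C := by
  obtain ⟨a, ha⟩ := hA.exists_isGreatest hA'
  obtain ⟨b, hb⟩ := hB.exists_isLeast hB'
  -- With `a = max A` and `b = min B`, the translates `A + b` and `B + a` both lie in `2C` and can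
  -- meet only at `a + b`.
  have h1 : volume ((fun z : ℝ => z + -b) ⁻¹' A) = volume A := measure_preimage_add_right _ _ _
  have h2 : volume ((fun z : ℝ => z + -a) ⁻¹' B) = volume B := measure_preimage_add_right _ _ _
  have h3 : volume ((fun z : ℝ => 2⁻¹ * z) ⁻¹' C) = 2 * volume C := by
    rw [Real.volume_preimage_mul_left (by norm_num)]
    norm_num
  have hd : AEDisjoint volume ((fun z : ℝ => z + -b) ⁻¹' A) ((fun z : ℝ => z + -a) ⁻¹' B) := by
    refine measure_mono_null (t := {a + b}) ?_ (by simp)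
    rintro z ⟨hz1, hz2⟩
    have e1 := ha.2 hz1
    have e2 := hb.2 hz2
    simp only [Set.mem_singleton_iff]
    linarith
  rw [← h1, ← h2, ← h3, ← measure_union₀ (hB.measurableSet.preimage (by fun_prop)).nullMeasurableSet hd]
  refine measure_mono ?_
  rintro z (hz | hz)
  · have := h _ hz b hb.1
    simpa using this
  · have := h a ha.1 _ hz
    simpa using this

/-- The one-dimensional Brunn–Minkowski inequality for midpoints. -/
theorem volume_add_volume_le {A B C : Set ℝ} (hA : MeasurableSet A) (hB : MeasurableSet B)
    (hA' : A.Nonempty) (hB' : B.Nonempty) (h : ∀ x ∈ A, ∀ y ∈ B, (2⁻¹ : ℝ) * (x + y) ∈ C) :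
    volume A + volume B ≤ 2 * volume C := by
  obtain ⟨a, ha⟩ := hA'
  obtain ⟨b, hb⟩ := hB'
  rw [hA.measure_eq_iSup_isCompact, hB.measure_eq_iSup_isCompact]
  simp only [iSup_and']
  refine ENNReal.biSup_add_biSup_le' ⟨∅, by simp⟩ ⟨∅, by simp⟩ fun S hS T hT => ?_
  refine (add_le_add (measure_mono (Set.subset_insert a S))
    (measure_mono (Set.subset_insert b T))).trans ?_
  refine volume_add_volume_le_of_isCompact (hS.2.insert a) (hT.2.insert b) (Set.insert_nonempty _ _)
    (Set.insert_nonempty _ _) fun x hx y hy =>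
      h x (Set.insert_subset ha hS.1 hx) y (Set.insert_subset hb hT.1 hy)

theorem lintegral_eq_setLIntegral_Ioo {α : Type*} [MeasurableSpace α] (μ : Measure α)
    {f : α → ℝ≥0∞} (hf : Measurable f) (h1 : ∀ x, f x ≤ 1) :
    ∫⁻ x, f x ∂μ = ∫⁻ t in Set.Ioo (0 : ℝ) 1, μ {x | ENNReal.ofReal t < f x} := by
  have e : ∀ x, f x = ENNReal.ofReal (f x).toReal := fun x =>
    (ENNReal.ofReal_toReal ((h1 x).trans_lt ENNReal.one_lt_top).ne).symm
  rw [lintegral_congr e, lintegral_eq_lintegral_meas_lt μ (Filter.Eventually.of_forall fun x => ENNReal.toReal_nonneg)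
    hf.ennreal_toReal.aemeasurable]
  rw [← Set.Ioo_union_Ici_eq_Ioi (zero_lt_one' ℝ), lintegral_union measurableSet_Ici
    (Set.disjoint_left.2 fun x hx hx' => absurd hx.2 (not_lt.2 hx'))]
  have z : ∫⁻ t in Set.Ici (1 : ℝ), μ {a | t < (f a).toReal} = 0 := by
    rw [setLIntegral_congr_fun (g := fun _ => 0) measurableSet_Ici, lintegral_zero]
    intro t ht
    convert measure_empty (μ := μ)
    ext x
    simp only [Set.mem_ofPred_eq, Set.mem_empty_iff_false, iff_false, not_lt]
    exact (ENNReal.toReal_mono ENNReal.one_ne_top (h1 x)).trans (by simpa using ht)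
  rw [z, add_zero]
  refine setLIntegral_congr_fun measurableSet_Ioo fun t ht => ?_
  congr 1
  ext x
  simp only [Set.mem_ofPred_eq]
  rw [ENNReal.ofReal_lt_iff_lt_toReal ht.1.le ((h1 x).trans_lt ENNReal.one_lt_top).ne]

/-- When both suprema are `1`, the superlevel sets at every level `t < 1` are nonempty, and
midpoints of `{f > t}` and `{g > t}` lie in `{h > t}`. One-dimensional Brunn–Minkowski at each level
is then integrated over `t`. -/
theorem lintegral_add_lintegral_le_of_normalized {f g h : ℝ → ℝ≥0∞} (hf : Measurable f)
    (hg : Measurable g) (hh : Measurable h) (hf1 : ∀ x, f x ≤ 1) (hg1 : ∀ x, g x ≤ 1)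
    (hf' : ∀ t < 1, ∃ x, t < f x) (hg' : ∀ t < 1, ∃ x, t < g x)
    (H : ∀ x y, f x * g y ≤ h (2⁻¹ * (x + y)) ^ 2) :
    (∫⁻ x, f x) + ∫⁻ x, g x ≤ 2 * ∫⁻ x, h x := by
  have hmin : ∫⁻ x, min (h x) 1 ≤ ∫⁻ x, h x := lintegral_mono fun x => min_le_left _ _
  grw [← hmin]
  rw [lintegral_eq_setLIntegral_Ioo _ hf hf1, lintegral_eq_setLIntegral_Ioo _ hg hg1,
    lintegral_eq_setLIntegral_Ioo _ (hh.min measurable_const) (fun x => min_le_right _ _)]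
  have anti : ∀ φ : ℝ → ℝ≥0∞, Measurable (fun t : ℝ => volume {x | ENNReal.ofReal t < φ x}) := by
    intro φ
    refine Antitone.measurable fun s t hst => measure_mono fun x hx => ?_
    exact (ENNReal.ofReal_le_ofReal hst).trans_lt hx
  rw [← lintegral_add_left (anti f), ← lintegral_const_mul _ (anti _)]
  refine setLIntegral_mono' measurableSet_Ioo fun t ht => ?_
  have ht1 : ENNReal.ofReal t < 1 := by simpa using ht.2
  refine volume_add_volume_le (measurableSet_lt measurable_const hf)
    (measurableSet_lt measurable_const hg) (hf' _ ht1) (hg' _ ht1) fun x hx y hy => ?_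
  refine lt_min ?_ ht1
  have := (ENNReal.mul_lt_mul hx hy).trans_le (H x y)
  rw [← sq] at this
  exact not_le.1 fun hle => absurd this (not_lt.2 (pow_le_pow_left' hle 2))

theorem four_mul_mul_le_add_sq (u v : ℝ≥0∞) : 4 * (u * v) ≤ (u + v) ^ 2 := by
  rcases eq_or_ne u ⊤ with rfl | hu
  · simp
  rcases eq_or_ne v ⊤ with rfl | hv
  · simp
  lift u to ℝ≥0 using hu
  lift v to ℝ≥0 using hv
  norm_cast
  rw [← NNReal.coe_le_coe]
  push_cast
  nlinarith [sq_nonneg ((u : ℝ) - v)]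

/-- Dividing `f`, `g`, `h` by `sup f`, `sup g` and the geometric mean of the two reduces to the
additive inequality, which AM–GM turns into a product. -/
theorem lintegral_mul_lintegral_le_of_bounded {f g h : ℝ → ℝ≥0∞} (hf : Measurable f)
    (hg : Measurable g) (hh : Measurable h) {M N : ℝ≥0∞} (hM : M ≠ ⊤) (hN : N ≠ ⊤)
    (hf1 : ∀ x, f x ≤ M) (hg1 : ∀ x, g x ≤ N)
    (H : ∀ x y, f x * g y ≤ h (2⁻¹ * (x + y)) ^ 2) :
    (∫⁻ x, f x) * ∫⁻ x, g x ≤ (∫⁻ x, h x) ^ 2 := by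
  set a := ⨆ x, f x with ha
  set b := ⨆ x, g x with hb
  have ha' : a ≠ ⊤ := ((iSup_le hf1).trans_lt hM.lt_top).ne
  have hb' : b ≠ ⊤ := ((iSup_le hg1).trans_lt hN.lt_top).ne
  rcases eq_or_ne a 0 with h0 | ha0
  · have : ∀ x, f x = 0 := by simpa [ha] using h0
    simp [this]
  rcases eq_or_ne b 0 with h0 | hb0
  · have : ∀ x, g x = 0 := by simpa [hb] using h0
    simp [this]
  set c := (a * b) ^ (1 / 2 : ℝ) with hc
  have hc2 : c ^ 2 = a * b := by
    rw [hc, ← ENNReal.rpow_natCast, ← ENNReal.rpow_mul]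
    norm_num
  have hc' : c ≠ ⊤ := ENNReal.rpow_ne_top_of_nonneg (by norm_num) (ENNReal.mul_ne_top ha' hb')
  have hc0 : c ≠ 0 := by
    intro h
    rw [h] at hc2
    simp [ha0, hb0] at hc2
  have key := lintegral_add_lintegral_le_of_normalized (f := fun x => a⁻¹ * f x)
    (g := fun x => b⁻¹ * g x) (h := fun x => c⁻¹ * h x) (by fun_prop) (by fun_prop) (by fun_prop)
    (fun x => ?_) (fun x => ?_) (fun t ht => ?_) (fun t ht => ?_) (fun x y => ?_)
  rotate_left
  · rw [mul_comm, ← div_eq_mul_inv]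
    exact ENNReal.div_le_of_le_mul (by simpa using le_iSup f x)
  · rw [mul_comm, ← div_eq_mul_inv]
    exact ENNReal.div_le_of_le_mul (by simpa using le_iSup g x)
  · have : a * t < ⨆ x, f x := by
      rw [← ha]
      conv_rhs => rw [← mul_one a]
      exact ENNReal.mul_lt_mul_right ha0 ha' ht
    obtain ⟨x, hx⟩ := lt_iSup_iff.1 this
    exact ⟨x, by
      rw [mul_comm, ← div_eq_mul_inv]
      rwa [ENNReal.lt_div_iff_mul_lt (Or.inl ha0) (Or.inl ha'), mul_comm]⟩
  · have : b * t < ⨆ x, g x := by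
      rw [← hb]
      conv_rhs => rw [← mul_one b]
      exact ENNReal.mul_lt_mul_right hb0 hb' ht
    obtain ⟨x, hx⟩ := lt_iSup_iff.1 this
    exact ⟨x, by
      rw [mul_comm, ← div_eq_mul_inv]
      rwa [ENNReal.lt_div_iff_mul_lt (Or.inl hb0) (Or.inl hb'), mul_comm]⟩
  · rw [mul_pow, ← ENNReal.inv_pow, hc2, ENNReal.mul_inv (Or.inl ha0) (Or.inl ha')]
    calc a⁻¹ * f x * (b⁻¹ * g y) = a⁻¹ * b⁻¹ * (f x * g y) := by ring
      _ ≤ _ := by gcongr; exact H x y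
  rw [lintegral_const_mul _ hf, lintegral_const_mul _ hg, lintegral_const_mul _ hh] at key
  set F := ∫⁻ x, f x
  set G := ∫⁻ x, g x
  set K := ∫⁻ x, h x
  have h4 := (four_mul_mul_le_add_sq (a⁻¹ * F) (b⁻¹ * G)).trans (pow_le_pow_left₀ zero_le key 2)
  have e1 : 4 * (a⁻¹ * F * (b⁻¹ * G)) = 4 * (c⁻¹ ^ 2 * (F * G)) := by
    rw [← ENNReal.inv_pow, hc2, ENNReal.mul_inv (Or.inl ha0) (Or.inl ha')]
    ring
  have e2 : (2 * (c⁻¹ * K)) ^ 2 = 4 * (c⁻¹ ^ 2 * K ^ 2) := by ring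
  rw [e1, e2] at h4
  rwa [ENNReal.mul_le_mul_iff_right (by norm_num) (by norm_num),
    ENNReal.mul_le_mul_iff_right (by simp [hc']) (by simp [hc0])] at h4

/-- The Prékopa–Leindler inequality on the line, for midpoints. -/
theorem lintegral_mul_lintegral_le {f g h : ℝ → ℝ≥0∞} (hf : Measurable f)
    (hg : Measurable g) (hh : Measurable h)
    (H : ∀ x y, f x * g y ≤ h (2⁻¹ * (x + y)) ^ 2) :
    (∫⁻ x, f x) * ∫⁻ x, g x ≤ (∫⁻ x, h x) ^ 2 := by
  -- Truncating `f` and `g` preserves the hypothesis, so monotone convergence removes the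
  -- boundedness assumption.
  have tr : ∀ φ : ℝ → ℝ≥0∞, Measurable φ → ∫⁻ x, φ x = ⨆ k : ℕ, ∫⁻ x, min (φ x) k := by
    intro φ hφ
    rw [← lintegral_iSup (fun k => hφ.min measurable_const)
      (fun i j hij x => min_le_min le_rfl (by exact_mod_cast hij))]
    refine lintegral_congr fun x => ?_
    rw [← inf_iSup_eq, ENNReal.iSup_natCast]
    simp
  rw [tr f hf, tr g hg, ENNReal.iSup_mul]
  refine iSup_le fun k => ?_
  rw [ENNReal.mul_iSup]
  refine iSup_le fun l => ?_
  refine lintegral_mul_lintegral_le_of_bounded (hf.min measurable_const) (hg.min measurable_const)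
    hh (M := k) (N := l) (by simp) (by simp) (fun x => min_le_right _ _)
    (fun x => min_le_right _ _) fun x y => (mul_le_mul' (min_le_left _ _) (min_le_left _ _)).trans (H x y)

theorem lintegral_pi_succ {n : ℕ} {f : (Fin (n + 1) → ℝ) → ℝ≥0∞} (hf : Measurable f) :
    ∫⁻ x, f x = ∫⁻ s : ℝ, ∫⁻ v : Fin n → ℝ, f (Fin.cons s v) := by
  rw [← (volume_preserving_piFinSuccAbove (fun _ : Fin (n + 1) => ℝ) 0).symm.lintegral_comp hf,
    Measure.volume_eq_prod, lintegral_prod _ (by fun_prop)]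
  refine lintegral_congr fun s => lintegral_congr fun v => congrArg f ?_
  ext i
  refine Fin.cases ?_ (fun j => ?_) i <;> simp [MeasurableEquiv.piFinSuccAbove]

/-- The Prékopa–Leindler inequality, for midpoints. -/
theorem lintegral_mul_lintegral_le_pi {n : ℕ} {f g h : (Fin n → ℝ) → ℝ≥0∞} (hf : Measurable f)
    (hg : Measurable g) (hh : Measurable h)
    (H : ∀ x y, f x * g y ≤ h ((2⁻¹ : ℝ) • (x + y)) ^ 2) :
    (∫⁻ x, f x) * ∫⁻ x, g x ≤ (∫⁻ x, h x) ^ 2 := by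
  induction n with
  | zero =>
    simp only [lintegral_unique, volume_pi, Measure.pi_univ, Finset.univ_eq_empty,
      Finset.prod_empty, mul_one]
    exact (H _ _).trans_eq (by rw [Subsingleton.elim ((2⁻¹ : ℝ) • _)])
  | succ n ih =>
    have hc : Measurable fun q : ℝ × (Fin n → ℝ) => (Fin.cons q.1 q.2 : Fin (n + 1) → ℝ) := by
      refine measurable_pi_lambda _ fun i => ?_
      refine Fin.cases ?_ (fun j => ?_) i
      · simpa using measurable_fst
      · simpa using (by fun_prop : Measurable fun c : ℝ × (Fin n → ℝ) => c.2 j)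
    rw [lintegral_pi_succ hf, lintegral_pi_succ hg, lintegral_pi_succ hh]
    have m : ∀ φ : (Fin (n + 1) → ℝ) → ℝ≥0∞, Measurable φ →
        Measurable fun s : ℝ => ∫⁻ v : Fin n → ℝ, φ (Fin.cons s v) := fun φ hφ =>
      Measurable.lintegral_prod_right' (f := fun q : ℝ × (Fin n → ℝ) => φ (Fin.cons q.1 q.2))
        (hφ.comp hc)
    -- The marginals in the first coordinate satisfy the one-dimensional hypothesis, by induction
    -- applied to the slices at `s`, `t` and their midpoint.
    refine lintegral_mul_lintegral_le (m f hf) (m g hg) (m h hh) fun s t => ?_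
    refine ih (hf.comp (hc.comp measurable_prodMk_left)) (hg.comp (hc.comp measurable_prodMk_left))
      (hh.comp (hc.comp measurable_prodMk_left)) fun x y => ?_
    convert H (Fin.cons s x) (Fin.cons t y) using 3
    ext i
    refine Fin.cases ?_ (fun j => ?_) i <;> simp [mul_add]

/-- The multiplicative Brunn–Minkowski inequality, for midpoints. -/
theorem volume_mul_volume_le {n : ℕ} {A B C : Set (E n)} (hA : MeasurableSet A)
    (hB : MeasurableSet B) (hC : MeasurableSet C)
    (h : ∀ x ∈ A, ∀ y ∈ B, (2⁻¹ : ℝ) • (x + y) ∈ C) :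
    volume A * volume B ≤ volume C ^ 2 := by
  have mp := PiLp.volume_preserving_toLp (Fin n)
  have me : Measurable (WithLp.toLp 2 : (Fin n → ℝ) → E n) := mp.measurable
  have e : ∀ S : Set (E n), MeasurableSet S → volume S =
      ∫⁻ x : Fin n → ℝ, S.indicator (fun _ => (1 : ℝ≥0∞)) (WithLp.toLp 2 x) := by
    intro S hS
    rw [mp.lintegral_comp (measurable_const.indicator hS), lintegral_indicator_const hS, one_mul]
  rw [e A hA, e B hB, e C hC]
  refine lintegral_mul_lintegral_le_pi ((measurable_const.indicator hA).comp me)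
    ((measurable_const.indicator hB).comp me) ((measurable_const.indicator hC).comp me)
    fun x y => ?_
  by_cases hx : WithLp.toLp 2 x ∈ A
  · by_cases hy : WithLp.toLp 2 y ∈ B
    · have := h _ hx _ hy
      rw [← WithLp.toLp_add, ← WithLp.toLp_smul] at this
      rw [Set.indicator_of_mem hx, Set.indicator_of_mem hy, Set.indicator_of_mem this]
      simp
    · simp [hy]
  · simp [hx]

/-! ### Moments of a random variable with geometric tail and second moment one. -/

/-- The tail `t ↦ μ {t ≤ Y}` is submultiplicative along arithmetic progressions, as is the case
when it is log-concave. -/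
def GeometricTail {Ω : Type*} [MeasurableSpace Ω] (μ : Measure Ω) (Y : Ω → ℝ≥0) : Prop :=
  ∀ s : ℝ≥0, 0 < s → ∀ k : ℕ, μ {ω | k * s ≤ Y ω} ≤ μ {ω | s ≤ Y ω} ^ k

section
variable {Ω : Type*} [MeasurableSpace Ω] {μ : Measure Ω} [IsProbabilityMeasure μ] {Y : Ω → ℝ≥0}

/-- Let `q` be the probability that `Y ≥ s`. If `q` is small, `Y` decays so fast on the scale `s`
that its second moment cannot be `1`: counting multiples of `2s` below `Y` gives `1 ≤ (2s/(1 -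
q))²`, that is, `1 - q ≤ 2s`. -/
theorem GeometricTail.measure_lt_le (hY : Measurable Y) (ht : GeometricTail μ Y)
    (h2 : ∫⁻ ω, (Y ω : ℝ≥0∞) ^ 2 ∂μ = 1) {s : ℝ≥0} (hs : 0 < s) :
    μ {ω | Y ω < s} ≤ 2 * s := by
  -- The step is `2s` rather than `s` so that `μ (A i ∩ A j) ≤ q ^ (2 max(i, j)) ≤ q ^ i * q ^ j`,
  -- and the double sum factors into two geometric series.
  set A : ℕ → Set Ω := fun i => {ω | 2 * i * s ≤ Y ω} with hA
  have hAm : ∀ i, MeasurableSet (A i) := fun i => measurableSet_le measurable_const hY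
  set q := μ {ω | s ≤ Y ω} with hq
  have hq1 : q ≤ 1 := prob_le_one
  have hd : μ {ω | Y ω < s} = 1 - q := by
    rw [hq, ← prob_compl_eq_one_sub (measurableSet_le measurable_const hY)]
    congr 1
    ext ω
    simp
  have hAi : ∀ i j, μ (A i ∩ A j) ≤ q ^ i * q ^ j := by
    intro i j
    have aux : ∀ i j : ℕ, i ≤ j → μ (A j) ≤ q ^ i * q ^ j := by
      intro i j hij
      have h := ht s hs (2 * j)
      push_cast at h
      refine h.trans ?_
      rw [← pow_add]
      exact pow_le_pow_of_le_one zero_le hq1 (by omega)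
    rcases le_total i j with h | h
    · exact (measure_mono Set.inter_subset_right).trans (aux i j h)
    · rw [mul_comm]
      exact (measure_mono Set.inter_subset_left).trans (aux j i h)
  have pt : ∀ ω, (Y ω : ℝ≥0∞) ≤ 2 * s * ∑' i, (A i).indicator (fun _ => (1 : ℝ≥0∞)) ω := by
    intro ω
    set l := ⌊Y ω / (2 * s)⌋₊ with hl
    have h1 : ((l + 1 : ℕ) : ℝ≥0∞) ≤ ∑' i, (A i).indicator (fun _ => (1 : ℝ≥0∞)) ω := by
      refine le_trans (le_of_eq ?_) (ENNReal.sum_le_tsum (Finset.range (l + 1)))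
      rw [Finset.sum_congr rfl (g := fun _ => (1 : ℝ≥0∞))]
      · simp
      · intro i hi
        refine Set.indicator_of_mem ?_ _
        have hi' : (i : ℝ≥0) ≤ Y ω / (2 * s) :=
          le_trans (by exact_mod_cast Nat.lt_succ_iff.1 (Finset.mem_range.1 hi)) (Nat.floor_le zero_le)
        rw [le_div_iff₀ (by positivity)] at hi'
        simp only [hA, Set.mem_ofPred_eq]
        calc 2 * (i : ℝ≥0) * s = i * (2 * s) := by ring
          _ ≤ _ := hi'
    refine le_trans ?_ (mul_le_mul_right h1 _)
    have h3 : Y ω / (2 * s) < (l + 1 : ℕ) := by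
      push_cast
      exact Nat.lt_floor_add_one _
    rw [div_lt_iff₀ (by positivity), mul_comm] at h3
    exact_mod_cast h3.le
  have key : (1 : ℝ≥0∞) ≤ (2 * s * (1 - q)⁻¹) ^ 2 := by
    calc (1 : ℝ≥0∞) = ∫⁻ ω, (Y ω : ℝ≥0∞) ^ 2 ∂μ := h2.symm
      _ ≤ ∫⁻ ω, (2 * s) ^ 2 * ∑' i, ∑' j, (A i ∩ A j).indicator (fun _ => (1 : ℝ≥0∞)) ω ∂μ := by
        refine lintegral_mono fun ω => (pow_le_pow_left' (pt ω) 2).trans_eq ?_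
        rw [mul_pow, sq (∑' i, _), ← ENNReal.tsum_mul_right]
        congr 1
        refine tsum_congr fun i => ?_
        rw [← ENNReal.tsum_mul_left]
        refine tsum_congr fun j => ?_
        rw [← Set.inter_indicator_mul]
        simp
      _ = (2 * s) ^ 2 * ∑' i, ∑' j, μ (A i ∩ A j) := by
        have m : ∀ i j, Measurable ((A i ∩ A j).indicator (fun _ => (1 : ℝ≥0∞))) := fun i j =>
          measurable_const.indicator ((hAm i).inter (hAm j))
        rw [lintegral_const_mul _ (Measurable.tsum fun i => Measurable.tsum (m i)),
          lintegral_tsum fun i => (Measurable.tsum (m i)).aemeasurable]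
        congr 2
        ext i
        rw [lintegral_tsum fun j => (m i j).aemeasurable]
        congr 1
        ext j
        rw [lintegral_indicator_const ((hAm i).inter (hAm j)), one_mul]
      _ ≤ (2 * s) ^ 2 * ∑' i, ∑' j, q ^ i * q ^ j := by
        gcongr with i j
        exact hAi i j
      _ = (2 * s * (1 - q)⁻¹) ^ 2 := by
        simp_rw [ENNReal.tsum_mul_left, ENNReal.tsum_mul_right, ENNReal.tsum_geometric]
        ring
  have key' : (1 : ℝ≥0∞) ≤ 2 * s * (1 - q)⁻¹ := by
    by_contra hlt
    exact absurd key (not_le.2 (by simpa using pow_lt_one' (not_le.1 hlt) two_ne_zero))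
  rw [hd]
  rw [← div_eq_mul_inv, ENNReal.le_div_iff_mul_le (Or.inr (by simp [hs.ne'])) (Or.inl (by simp)), one_mul] at key'
  · exact key'

theorem rpow_le_rpow_of_nonpos_of_le {a b : ℝ≥0∞} {z : ℝ} (hz : z ≤ 0) (h : a ≤ b) :
    b ^ z ≤ a ^ z := by
  rw [← neg_neg z, ENNReal.rpow_neg _ (-z), ENNReal.rpow_neg _ (-z), ENNReal.inv_le_inv]
  exact ENNReal.rpow_le_rpow h (by linarith)

/-- Decompose by powers of `4`: where `Y` is about `4^{-j}` the integrand is at most `2^{j+1}`,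
while the small-ball estimate gives measure at most `4 · 4^{-j}`. The total is `1 + 8 · 2 = 17`. -/
theorem GeometricTail.lintegral_rpow_neg_le (hY : Measurable Y) (ht : GeometricTail μ Y)
    (h2 : ∫⁻ ω, (Y ω : ℝ≥0∞) ^ 2 ∂μ = 1) (h0 : ∀ᵐ ω ∂μ, Y ω ≠ 0) :
    ∫⁻ ω, (Y ω : ℝ≥0∞) ^ (-(1 / 2) : ℝ) ∂μ ≤ 17 := by
  set A : ℕ → Set Ω := fun j => {ω | Y ω < 2 * 4⁻¹ ^ j} with hA
  have hAm : ∀ i, MeasurableSet (A i) := fun i => measurableSet_lt hY measurable_const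
  have half : ∀ j : ℕ, (((4⁻¹ : ℝ≥0) ^ j : ℝ≥0) : ℝ≥0∞) ^ (-(1 / 2) : ℝ) = 2 ^ j := by
    intro j
    rw [← ENNReal.coe_rpow_of_ne_zero (by positivity)]
    have : ((4⁻¹ : ℝ≥0) ^ j) ^ (-(1 / 2) : ℝ) = 2 ^ j := by
      have e : (4⁻¹ : ℝ≥0) ^ j = (2 : ℝ≥0) ^ (-(2 * j) : ℝ) := by
        rw [NNReal.rpow_neg, NNReal.rpow_mul, inv_pow, NNReal.rpow_natCast]
        norm_num
      rw [e, ← NNReal.rpow_mul, ← NNReal.rpow_natCast]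
      congr 1
      ring
    rw [this]
    norm_cast
  have pt : ∀ ω, Y ω ≠ 0 → (Y ω : ℝ≥0∞) ^ (-(1 / 2) : ℝ) ≤
      1 + ∑' j, (A j).indicator (fun _ => (2 : ℝ≥0∞) ^ (j + 1)) ω := by
    intro ω hω
    rcases le_total 1 (Y ω) with h1 | h1
    · refine le_add_right ?_
      calc (Y ω : ℝ≥0∞) ^ (-(1 / 2) : ℝ) ≤ 1 ^ (-(1 / 2) : ℝ) :=
            rpow_le_rpow_of_nonpos_of_le (by norm_num) (by exact_mod_cast h1)
        _ = 1 := by simp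
    · obtain ⟨j, hj1, hj2⟩ := exists_nat_pow_near_of_lt_one (y := (4⁻¹ : ℝ≥0))
        (pos_iff_ne_zero.2 hω) h1 (by positivity) (by
          rw [← NNReal.coe_lt_coe]; push_cast; norm_num)
      refine le_add_left (le_trans ?_ (ENNReal.le_tsum j))
      rw [Set.indicator_of_mem]
      · rw [← half]
        exact rpow_le_rpow_of_nonpos_of_le (by norm_num) (by exact_mod_cast hj1.le)
      · refine hj2.trans_lt ?_
        have : (0 : ℝ≥0) < 4⁻¹ ^ j := by positivity
        rw [two_mul]
        exact lt_add_of_pos_left _ this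
  have hAμ : ∀ j, μ (A j) ≤ 4 * 4⁻¹ ^ j := by
    intro j
    refine (ht.measure_lt_le hY h2 (s := 2 * 4⁻¹ ^ j) (by positivity)).trans_eq ?_
    rw [ENNReal.coe_mul, ← mul_assoc, ENNReal.coe_pow, ENNReal.coe_inv (by norm_num)]
    norm_num
  calc ∫⁻ ω, (Y ω : ℝ≥0∞) ^ (-(1 / 2) : ℝ) ∂μ
      ≤ ∫⁻ ω, (1 + ∑' j, (A j).indicator (fun _ => (2 : ℝ≥0∞) ^ (j + 1)) ω) ∂μ :=
        lintegral_mono_ae (h0.mono pt)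
    _ = 1 + ∑' j, 2 ^ (j + 1) * μ (A j) := by
        rw [lintegral_add_left measurable_const, lintegral_tsum fun j =>
          (measurable_const.indicator (hAm j)).aemeasurable]
        simp [lintegral_indicator_const (hAm _)]
    _ ≤ 1 + ∑' j : ℕ, 8 * 2⁻¹ ^ j := by
        refine add_le_add_right (ENNReal.tsum_le_tsum fun j => ?_) _
        refine (mul_le_mul_right (hAμ j) _).trans_eq ?_
        have : (4⁻¹ : ℝ≥0∞) = 2⁻¹ * 2⁻¹ := by
          rw [← ENNReal.mul_inv (by simp) (by simp)]; norm_num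
        have h' : (2 : ℝ≥0∞) ^ j * 2⁻¹ ^ j = 1 := by
          rw [← mul_pow, ENNReal.mul_inv_cancel (by simp) (by simp), one_pow]
        rw [this, mul_pow, pow_succ]
        calc (2 : ℝ≥0∞) ^ j * 2 * (4 * (2⁻¹ ^ j * 2⁻¹ ^ j))
            = 8 * ((2 : ℝ≥0∞) ^ j * 2⁻¹ ^ j) * 2⁻¹ ^ j := by ring
          _ = _ := by rw [h', mul_one]
    _ = 17 := by
        rw [ENNReal.tsum_mul_left, ENNReal.tsum_geometric, ENNReal.one_sub_inv_two, inv_inv]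
        norm_num

/-- Hölder interpolates the moment of order `0`, which is `1`, between those of orders `p` and
`-1/2`. The resulting factor `17^{2p} = 289^p` keeps a constant independent of `p` after taking
`p`-th roots, even as `p → 0`. -/
theorem GeometricTail.one_le_mul_lintegral_rpow (hY : Measurable Y) (ht : GeometricTail μ Y)
    (h2 : ∫⁻ ω, (Y ω : ℝ≥0∞) ^ 2 ∂μ = 1) {p : ℝ} (hp : 0 < p) :
    1 ≤ 289 ^ p * ∫⁻ ω, (Y ω : ℝ≥0∞) ^ p ∂μ := by
  have h0 : ∀ᵐ ω ∂μ, Y ω ≠ 0 := by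
    rw [ae_iff]
    refine le_antisymm (le_of_forall_pos_le_add fun ε hε => ?_) zero_le
    rcases eq_or_ne ε ⊤ with rfl | hε'
    · simp
    lift ε to ℝ≥0 using hε'
    have hε0 : 0 < ε := by exact_mod_cast hε
    have := ht.measure_lt_le hY h2 (s := ε / 2) (by positivity)
    rw [zero_add]
    refine (measure_mono fun ω hω => ?_).trans (this.trans_eq ?_)
    · have : Y ω = 0 := by simpa using hω
      simp [this, hε0]
    · rw [ENNReal.coe_div two_ne_zero]
      exact ENNReal.mul_div_cancel (by simp) (by simp)
  have hneg := ht.lintegral_rpow_neg_le hY h2 h0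
  set α := 1 / (1 + 2 * p) with hα
  have hβ : 1 - α = 2 * p * α := by rw [hα]; field_simp; ring
  have hα0 : 0 < α := by positivity
  have hZ : Measurable fun ω => (Y ω : ℝ≥0∞) := hY.coe_nnreal_ennreal
  have hol := ENNReal.lintegral_mul_norm_pow_le (μ := μ) (p := α) (q := 2 * p * α)
    (hZ.pow_const p).aemeasurable (hZ.pow_const (-(1 / 2) : ℝ)).aemeasurable hα0.le (by positivity)
    (by linarith)
  have one : ∫⁻ ω, ((Y ω : ℝ≥0∞) ^ p) ^ α * ((Y ω : ℝ≥0∞) ^ (-(1 / 2) : ℝ)) ^ (2 * p * α) ∂μ = 1 := by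
    rw [lintegral_congr_ae (g := fun _ => 1)]
    · simp
    -- The weight `α = 1/(1 + 2p)` is chosen so that `p α - (1/2)(2 p α) = 0` and the two weights
    -- add up to `1`.
    · filter_upwards [h0] with ω hω
      rw [← ENNReal.rpow_mul, ← ENNReal.rpow_mul, ← ENNReal.rpow_add _ _ (by simpa using hω) (by simp)]
      convert ENNReal.rpow_zero using 2
      ring
  rw [one] at hol
  have h3 : 1 ≤ (∫⁻ ω, (Y ω : ℝ≥0∞) ^ p ∂μ) ^ α * 17 ^ (2 * p * α) :=
    hol.trans (mul_le_mul_right (ENNReal.rpow_le_rpow hneg (by positivity)) _)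
  have h4 := ENNReal.rpow_le_rpow h3 (z := 1 / α) (by positivity)
  rw [ENNReal.one_rpow, ENNReal.mul_rpow_of_nonneg _ _ (by positivity), ← ENNReal.rpow_mul,
    ← ENNReal.rpow_mul, mul_one_div_cancel hα0.ne', ENNReal.rpow_one, mul_assoc,
    mul_one_div_cancel hα0.ne', mul_one, ENNReal.rpow_mul, mul_comm] at h4
  convert h4 using 3
  norm_cast

theorem lintegral_rpow_le_one_of_le_two (hY : Measurable Y)
    (h2 : ∫⁻ ω, (Y ω : ℝ≥0∞) ^ 2 ∂μ = 1) {p : ℝ} (hp : 0 < p) (hp2 : p ≤ 2) :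
    ∫⁻ ω, (Y ω : ℝ≥0∞) ^ p ∂μ ≤ 1 := by
  have hZ : Measurable fun ω => (Y ω : ℝ≥0∞) := hY.coe_nnreal_ennreal
  have := ENNReal.lintegral_mul_norm_pow_le (μ := μ) (p := p / 2) (q := 1 - p / 2)
    (hZ.pow_const (2 : ℝ)).aemeasurable (g := fun _ => 1) aemeasurable_const (by positivity)
    (by linarith) (by linarith)
  simp only [ENNReal.one_rpow, mul_one, ← ENNReal.rpow_mul] at this
  refine le_trans (le_of_eq ?_) (this.trans_eq ?_)
  · congr! 3
    ring
  · have e : ∀ ω, (Y ω : ℝ≥0∞) ^ (2 : ℝ) = (Y ω : ℝ≥0∞) ^ 2 := fun ω => by norm_cast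
    simp [e, h2]

end

/-- Chebyshev gives `μ {Y ≥ 2} ≤ 1/4`, so `μ {Y ≥ 2j} ≤ 4^{-j}`. Since `Y^p ≤ (4p)^p 2^{Y/2}`, the
geometric decay beats the growth of `2^{Y/2}` and the series sums to `4 ≤ 4^p`. -/
theorem GeometricTail.lintegral_rpow_le {Ω : Type*} [MeasurableSpace Ω] {μ : Measure Ω}
    {Y : Ω → ℝ≥0} (hY : Measurable Y) (ht : GeometricTail μ Y)
    (h2 : ∫⁻ ω, (Y ω : ℝ≥0∞) ^ 2 ∂μ = 1) {p : ℝ} (hp : 1 ≤ p) :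
    ∫⁻ ω, (Y ω : ℝ≥0∞) ^ p ∂μ ≤ ENNReal.ofReal ((16 * p) ^ p) := by
  have hZ : Measurable fun ω => (Y ω : ℝ≥0∞) := hY.coe_nnreal_ennreal
  set q := μ {ω | 2 ≤ Y ω} with hq
  have hq4 : 4 * q ≤ 1 := by
    have := mul_meas_ge_le_lintegral (μ := μ) (hZ.pow_const 2) 4
    rw [h2] at this
    convert this using 3
    ext ω
    simp only [Set.mem_ofPred_eq]
    norm_cast
    rw [show (4 : ℝ≥0) = 2 ^ 2 by norm_num, pow_le_pow_iff_left₀ zero_le zero_le two_ne_zero]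
  set A : ℕ → Set Ω := fun j => {ω | j * 2 ≤ Y ω} with hA
  have hAm : ∀ i, MeasurableSet (A i) := fun i => measurableSet_le measurable_const hY
  have pt : ∀ ω, (Y ω : ℝ≥0∞) ^ p ≤
      ENNReal.ofReal ((4 * p) ^ p) * ∑' j, (A j).indicator (fun _ => (2 : ℝ≥0∞) ^ (j + 1)) ω := by
    intro ω
    set l := ⌊Y ω / 2⌋₊ with hl
    have h1 : (2 : ℝ≥0∞) ^ (l + 1) ≤ ∑' j, (A j).indicator (fun _ => (2 : ℝ≥0∞) ^ (j + 1)) ω := by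
      refine le_trans (le_of_eq ?_) (ENNReal.le_tsum l)
      rw [Set.indicator_of_mem]
      have : (l : ℝ≥0) ≤ Y ω / 2 := Nat.floor_le zero_le
      rwa [le_div_iff₀ (by positivity)] at this
    refine le_trans ?_ (mul_le_mul_right h1 _)
    have h3 : (Y ω : ℝ) / 2 < l + 1 := by
      have : Y ω / 2 < l + 1 := Nat.lt_floor_add_one _
      exact_mod_cast this
    have h4 : (Y ω : ℝ) ^ p ≤ (4 * p) ^ p * 2 ^ (l + 1) := by
      have hy : 0 ≤ (Y ω : ℝ) := (Y ω).2
      generalize (Y ω : ℝ) = y at *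
      -- This is `x ≤ exp x` at `x = log 2 · y/(2p)`, together with `2 log 2 ≥ 1`.
      have e1 : y ≤ 4 * p * Real.exp (Real.log 2 * (y / 2) / p) := by
        have := Real.add_one_le_exp (Real.log 2 * (y / 2) / p)
        have l2 := Real.log_two_gt_d9
        calc y ≤ 4 * p * (Real.log 2 * (y / 2) / p) := by
              rw [show 4 * p * (Real.log 2 * (y / 2) / p) = 2 * Real.log 2 * y by
                field_simp; ring]
              nlinarith
          _ ≤ _ := by gcongr; linarith
      calc y ^ p ≤ (4 * p * Real.exp (Real.log 2 * (y / 2) / p)) ^ p :=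
            Real.rpow_le_rpow hy e1 (by positivity)
        _ = (4 * p) ^ p * Real.exp (Real.log 2 * (y / 2)) := by
            rw [Real.mul_rpow (by positivity) (by positivity), ← Real.exp_mul]
            congr 2
            field_simp
        _ ≤ (4 * p) ^ p * Real.exp (Real.log 2 * (l + 1 : ℕ)) := by
            push_cast
            have : 0 ≤ Real.log 2 := Real.log_nonneg (by norm_num)
            gcongr
        _ = _ := by
            rw [Real.exp_mul, Real.exp_log (by norm_num), Real.rpow_natCast]
    calc (Y ω : ℝ≥0∞) ^ p = ENNReal.ofReal ((Y ω : ℝ) ^ p) := by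
          rw [← ENNReal.ofReal_rpow_of_nonneg NNReal.zero_le_coe (by positivity),
            ENNReal.ofReal_coe_nnreal]
      _ ≤ ENNReal.ofReal ((4 * p) ^ p * 2 ^ (l + 1)) := ENNReal.ofReal_le_ofReal h4
      _ = _ := by
          rw [ENNReal.ofReal_mul (by positivity), ENNReal.ofReal_pow (by norm_num)]
          norm_num
  calc ∫⁻ ω, (Y ω : ℝ≥0∞) ^ p ∂μ
      ≤ ∫⁻ ω, (ENNReal.ofReal ((4 * p) ^ p) *
          ∑' j, (A j).indicator (fun _ => (2 : ℝ≥0∞) ^ (j + 1)) ω) ∂μ := lintegral_mono pt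
    _ = ENNReal.ofReal ((4 * p) ^ p) * ∑' j, 2 ^ (j + 1) * μ (A j) := by
        rw [lintegral_const_mul _ (Measurable.tsum fun j =>
          measurable_const.indicator (hAm j)), lintegral_tsum fun j =>
          (measurable_const.indicator (hAm j)).aemeasurable]
        simp [lintegral_indicator_const (hAm _)]
    _ ≤ ENNReal.ofReal ((4 * p) ^ p) * ∑' j : ℕ, 2 * 2⁻¹ ^ j := by
        refine mul_le_mul_right (ENNReal.tsum_le_tsum fun j => ?_) _
        have hj := ht 2 (by norm_num) j
        have h' : 2 * q ≤ 2⁻¹ := by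
          rw [← ENNReal.mul_le_mul_iff_right (a := 2) (by simp) (by simp),
            ENNReal.mul_inv_cancel (by simp) (by simp), ← mul_assoc]
          norm_num
          exact hq4
        calc (2 : ℝ≥0∞) ^ (j + 1) * μ (A j) ≤ 2 ^ (j + 1) * q ^ j := by gcongr
          _ = 2 * (2 * q) ^ j := by rw [mul_pow]; ring
          _ ≤ _ := by gcongr
    _ = ENNReal.ofReal ((4 * p) ^ p) * 4 := by
        rw [ENNReal.tsum_mul_left, ENNReal.tsum_geometric, ENNReal.one_sub_inv_two, inv_inv]
        norm_num
    _ = ENNReal.ofReal ((4 * p) ^ p * 4) := by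
        rw [ENNReal.ofReal_mul (by positivity)]
        norm_num
    _ ≤ _ := by
        refine ENNReal.ofReal_le_ofReal ?_
        rw [show 16 * p = 4 * p * 4 by ring, Real.mul_rpow (by positivity) (by norm_num) (y := 4)]
        gcongr
        exact Real.self_le_rpow_of_one_le (by norm_num) hp

/-! ### Linear functionals on a symmetric convex body. -/

/-- The ratios `u (k + 1) / u k` decrease from `u 1 / u 0 = u 1`. Monotonicity is needed past a zero
of `u`, where log-concavity alone says nothing. -/
theorem le_pow_of_logConcave {u : ℕ → ℝ} (h0 : u 0 = 1) (hnn : ∀ k, 0 ≤ u k) (ha : Antitone u)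
    (hl : ∀ k, u k * u (k + 2) ≤ u (k + 1) ^ 2) (k : ℕ) : u k ≤ u 1 ^ k := by
  have step : ∀ k, u (k + 1) ≤ u 1 * u k := by
    intro k
    induction k with
    | zero => simp [h0]
    | succ k ih =>
      rcases (hnn k).eq_or_lt with h | h
      · have : u (k + 2) ≤ 0 := by rw [h]; exact ha (by omega)
        exact this.trans (mul_nonneg (hnn _) (hnn _))
      · refine le_of_mul_le_mul_left ((hl k).trans ?_) h
        rw [sq]
        calc u (k + 1) * u (k + 1) ≤ (u 1 * u k) * u (k + 1) := by
              gcongr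
              exact hnn _
          _ = _ := by ring
  induction k with
  | zero => simp [h0]
  | succ k ih =>
    refine (step k).trans ?_
    rw [pow_succ, mul_comm]
    gcongr
    exact hnn 1

section
variable {n : ℕ} {K : Set (E n)} {θ : E n}

theorem volume_neg_slab (hs : ∀ x ∈ K, -x ∈ K) (t : ℝ) :
    volume {x | x ∈ K ∧ inner ℝ x θ ≤ -t} = volume {x | x ∈ K ∧ t ≤ inner ℝ x θ} := by
  rw [← Measure.measure_neg]
  congr 1
  ext x
  simp only [Set.mem_neg, Set.mem_ofPred_eq, inner_neg_left]
  refine and_congr ⟨fun h => by simpa using hs _ h, fun h => hs _ h⟩ ?_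
  constructor <;> intro h <;> linarith

theorem volume_hyperplane (hθ : θ ≠ 0) : volume {x : E n | inner ℝ x θ = 0} = 0 := by
  have h := Measure.addHaar_submodule (volume : Measure (E n)) (LinearMap.ker (innerₛₗ ℝ θ)) (by
    rw [Ne, LinearMap.ker_eq_top]
    intro h
    have := LinearMap.congr_fun h θ
    simp [hθ] at this)
  convert h using 2
  ext x
  simp [real_inner_comm]

theorem measurableSet_slab (hK : MeasurableSet K) (t : ℝ) :
    MeasurableSet {x | x ∈ K ∧ t ≤ inner ℝ x θ} :=
  hK.inter (measurableSet_le (g := fun x : E n => inner ℝ x θ) measurable_const (by fun_prop))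

theorem measurableSet_slab' (hK : MeasurableSet K) (t : ℝ) :
    MeasurableSet {x | x ∈ K ∧ inner ℝ x θ ≤ t} :=
  hK.inter (measurableSet_le (f := fun x : E n => inner ℝ x θ) (by fun_prop) measurable_const)

theorem two_mul_volume_halfspace (hK : MeasurableSet K) (hs : ∀ x ∈ K, -x ∈ K) (hθ : θ ≠ 0) :
    2 * volume {x | x ∈ K ∧ 0 ≤ inner ℝ x θ} = volume K := by
  have hn := volume_neg_slab (θ := θ) hs 0
  rw [neg_zero] at hn
  rw [two_mul]
  nth_rw 2 [← hn]
  rw [← measure_union₀ (measurableSet_slab' hK 0).nullMeasurableSet]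
  · congr 1
    ext x
    simp only [Set.mem_union, Set.mem_ofPred_eq, ← and_or_left, and_iff_left_iff_imp]
    exact fun _ => le_total _ _
  · refine measure_mono_null (fun x hx => ?_) (volume_hyperplane hθ)
    exact le_antisymm hx.2.2 hx.1.2

theorem volume_abs_slab (hK : MeasurableSet K) (hs : ∀ x ∈ K, -x ∈ K) {t : ℝ} (ht : 0 < t) :
    volume {x | x ∈ K ∧ t ≤ |inner ℝ x θ|} = 2 * volume {x | x ∈ K ∧ t ≤ inner ℝ x θ} := by
  have hn := volume_neg_slab (θ := θ) hs t
  rw [two_mul]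
  nth_rw 2 [← hn]
  rw [← measure_union₀ (measurableSet_slab' hK _).nullMeasurableSet]
  · congr 1
    ext x
    simp only [Set.mem_union, Set.mem_ofPred_eq, ← and_or_left, le_abs]
    refine and_congr_right fun _ => or_congr_right ?_
    constructor <;> intro h <;> linarith
  · refine Disjoint.aedisjoint (Set.disjoint_left.2 fun x hx hx' => ?_)
    have h1 := hx.2
    have h2 := hx'.2
    linarith

theorem volume_slab_mul_le (hK : MeasurableSet K) (hc : Convex ℝ K) (s t : ℝ) :
    volume {x | x ∈ K ∧ s ≤ inner ℝ x θ} * volume {x | x ∈ K ∧ t ≤ inner ℝ x θ} ≤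
      volume {x | x ∈ K ∧ (s + t) / 2 ≤ inner ℝ x θ} ^ 2 := by
  refine volume_mul_volume_le (measurableSet_slab hK _) (measurableSet_slab hK _)
    (measurableSet_slab hK _) fun x hx y hy => ⟨?_, ?_⟩
  · rw [smul_add]
    exact hc hx.1 hy.1 (by norm_num) (by norm_num) (by norm_num)
  · have h1 := hx.2
    have h2 := hy.2
    rw [inner_smul_left, inner_add_left]
    simp only [map_inv₀, map_ofNat]
    linarith

/-- By symmetry the tail at `t > 0` is `2 G(tσ) / Vol(K)`, where `G` is the volume cut off by a
half-space. Brunn–Minkowski makes `G` midpoint log-concave, and halving by symmetry normalises the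
value at `0` to `1`. -/
theorem geometricTail_inner (hK : MeasurableSet K) (hc : Convex ℝ K) (hs : ∀ x ∈ K, -x ∈ K)
    (h0 : volume K ≠ 0) (h1 : volume K ≠ ⊤) (hθ : θ ≠ 0) {σ : ℝ≥0} (hσ : 0 < σ) :
    GeometricTail ((volume K)⁻¹ • volume.restrict K) (fun x => ‖inner ℝ x θ‖₊ / σ) := by
  intro s hs0 k
  have ms : ∀ t : ℝ≥0, MeasurableSet {x : E n | t ≤ ‖inner ℝ x θ‖₊ / σ} := fun t =>
    measurableSet_le measurable_const (by fun_prop)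
  set G : ℝ → ℝ≥0∞ := fun t => volume {x | x ∈ K ∧ t ≤ inner ℝ x θ} with hG
  have hGtop : ∀ t, G t ≠ ⊤ := fun t => ((measure_mono fun x hx => hx.1).trans_lt h1.lt_top).ne
  have hG0 : 2 * G 0 = volume K := two_mul_volume_halfspace hK hs hθ
  have tail : ∀ t : ℝ≥0, 0 < t → ((volume K)⁻¹ • volume.restrict K) {x : E n | t ≤ ‖inner ℝ x θ‖₊ / σ}
      = (volume K)⁻¹ * (2 * G (t * σ)) := by
    intro t ht
    rw [Measure.smul_apply, Measure.restrict_apply (ms t), smul_eq_mul, hG, ← volume_abs_slab hK hs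
      (by positivity)]
    congr 2
    ext x
    simp only [Set.mem_inter_iff, Set.mem_ofPred_eq, and_comm (b := x ∈ K)]
    refine and_congr_right fun _ => ?_
    rw [le_div_iff₀ hσ, ← NNReal.coe_le_coe]
    simp
  rcases Nat.eq_zero_or_pos k with rfl | hk
  · simp only [pow_zero, Measure.smul_apply, smul_eq_mul]
    calc (volume K)⁻¹ * _ ≤ (volume K)⁻¹ * volume.restrict K Set.univ := by
          gcongr; exact Set.subset_univ _
      _ = 1 := by rw [Measure.restrict_apply_univ, ENNReal.inv_mul_cancel h0 h1]
  · rw [tail _ hs0, tail _ (by positivity)]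
    set u : ℕ → ℝ := fun k => ((volume K)⁻¹ * (2 * G ((k : ℝ) * (s * σ)))).toReal with hu
    have hfin : ∀ t, (volume K)⁻¹ * (2 * G t) ≠ ⊤ := fun t =>
      ENNReal.mul_ne_top (by simp [h0]) (ENNReal.mul_ne_top (by simp) (hGtop t))
    have key := le_pow_of_logConcave (u := u) ?_ ?_ ?_ ?_ k
    · rw [hu] at key
      simp only [Nat.cast_one, one_mul] at key
      rw [← ENNReal.toReal_pow, ENNReal.toReal_le_toReal (hfin _) (ENNReal.pow_ne_top (hfin _))] at key
      convert key using 4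
      push_cast
      ring
    · simp only [hu, Nat.cast_zero, zero_mul, hG0]
      rw [ENNReal.inv_mul_cancel h0 h1, ENNReal.toReal_one]
    · exact fun _ => ENNReal.toReal_nonneg
    · intro i j hij
      refine ENNReal.toReal_mono (hfin _) ?_
      gcongr
      refine measure_mono fun x hx => ⟨hx.1, le_trans ?_ hx.2⟩
      gcongr
    · intro j
      simp only [hu]
      rw [← ENNReal.toReal_mul, ← ENNReal.toReal_pow]
      refine ENNReal.toReal_mono (ENNReal.pow_ne_top (hfin _)) ?_
      calc _ = ((volume K)⁻¹ * 2) ^ 2 * (G ((j : ℝ) * (s * σ)) * G (((j + 2 : ℕ) : ℝ) * (s * σ))) := by ring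
        _ ≤ ((volume K)⁻¹ * 2) ^ 2 * G (((j + 1 : ℕ) : ℝ) * (s * σ)) ^ 2 := by
          gcongr
          refine (volume_slab_mul_le hK hc _ _).trans_eq ?_
          congr! 6
          push_cast
          ring
        _ = _ := by ring

/-- A lower bound for the `L_2` mean of a linear functional by a multiple `1/n` of its maximum. -/
theorem inner_le_of_lintegral_sq (hn : 1 ≤ n) (hK : MeasurableSet K) (hc : Convex ℝ K)
    (hs : ∀ x ∈ K, -x ∈ K) (h0 : volume K ≠ 0) (h1 : volume K ≠ ⊤) (hθ : θ ≠ 0) {σ : ℝ≥0}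
    (h2 : ∫⁻ x in K, ‖inner ℝ x θ‖ₑ ^ 2 = volume K * σ ^ 2) {x₀ : E n} (hx₀ : x₀ ∈ K) :
    ‖inner ℝ x₀ θ‖₊ ≤ 4 * n * σ := by
  wlog hpos : 0 ≤ inner ℝ x₀ θ generalizing x₀
  · have := this (hs _ hx₀) (by rw [inner_neg_left]; linarith)
    simpa using this
  have hn' : (1 : ℝ) ≤ n := by exact_mod_cast hn
  set M : ℝ := inner ℝ x₀ θ with hM
  -- Shrinking the half-body towards `x₀` with ratio `1 - l` lands in the cap at height `l * M`. By
  -- Bernoulli `(1 - l)^n ≥ 1/2`, so the cap has at least a quarter of the volume, and Markov gives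
  -- `l * M ≤ 2σ`.
  set l : ℝ := 1 / (2 * n) with hl
  have hl0 : 0 < l := by positivity
  have hl1 : l ≤ 1 / 2 := by
    rw [hl]
    exact one_div_le_one_div_of_le (by norm_num) (by linarith)
  set A := {x | x ∈ K ∧ 0 ≤ inner ℝ x θ} with hA
  have hsub : AffineMap.homothety x₀ (1 - l) '' A ⊆ {x | x ∈ K ∧ l * M ≤ inner ℝ x θ} := by
    rintro _ ⟨y, hy, rfl⟩
    have e : AffineMap.homothety x₀ (1 - l) y = (1 - l) • y + l • x₀ := by
      rw [AffineMap.homothety_apply, vsub_eq_sub, vadd_eq_add]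
      module
    rw [e]
    refine ⟨hc hy.1 hx₀ (by linarith) hl0.le (by ring), ?_⟩
    rw [inner_add_left, inner_smul_left, inner_smul_left]
    simp only [conj_trivial]
    have : 0 ≤ (1 - l) * inner ℝ y θ := mul_nonneg (by linarith) hy.2
    linarith
  have hvol := measure_mono (μ := volume) hsub
  rw [Measure.addHaar_image_homothety] at hvol
  have hfr : Module.finrank ℝ (E n) = n := by simp
  have hbern : (1 / 2 : ℝ) ≤ |(1 - l) ^ Module.finrank ℝ (E n)| := by
    rw [hfr, abs_of_nonneg (pow_nonneg (by linarith) _)]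
    have := one_add_mul_le_pow (a := -l) (by linarith) n
    calc (1 / 2 : ℝ) = 1 + n * -l := by rw [hl]; field_simp; norm_num
      _ ≤ _ := this
  have hA2 : 2 * volume A = volume K := two_mul_volume_halfspace hK hs hθ
  have h4 : volume K ≤ 4 * volume {x | x ∈ K ∧ l * M ≤ inner ℝ x θ} := by
    rw [← hA2]
    calc 2 * volume A = 4 * (ENNReal.ofReal (1 / 2) * volume A) := by
          rw [← mul_assoc]
          congr 1
          rw [show (4 : ℝ≥0∞) = ENNReal.ofReal 4 by norm_num, ← ENNReal.ofReal_mul (by norm_num)]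
          norm_num
      _ ≤ 4 * (ENNReal.ofReal |(1 - l) ^ Module.finrank ℝ (E n)| * volume A) := by gcongr
      _ ≤ _ := by gcongr
  have hmar : ENNReal.ofReal (l * M) ^ 2 * volume {x | x ∈ K ∧ l * M ≤ inner ℝ x θ} ≤
      volume K * σ ^ 2 := by
    rw [← h2]
    have := mul_meas_ge_le_lintegral (μ := volume.restrict K) (f := fun x : E n => ‖inner ℝ x θ‖ₑ ^ 2)
      (by fun_prop) (ENNReal.ofReal (l * M) ^ 2)
    refine le_trans ?_ this
    refine mul_le_mul_right ?_ _
    rw [Measure.restrict_apply (measurableSet_le measurable_const (by fun_prop))]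
    refine measure_mono fun x hx => ⟨?_, hx.1⟩
    simp only [Set.mem_ofPred_eq]
    gcongr
    rw [← ofReal_norm]
    exact ENNReal.ofReal_le_ofReal (hx.2.trans (le_abs_self _))
  have h5 : ENNReal.ofReal (l * M) ^ 2 ≤ (2 * σ) ^ 2 := by
    rw [← ENNReal.mul_le_mul_iff_left h0 h1]
    calc ENNReal.ofReal (l * M) ^ 2 * volume K ≤
        ENNReal.ofReal (l * M) ^ 2 * (4 * volume {x | x ∈ K ∧ l * M ≤ inner ℝ x θ}) := by gcongr
      _ = 4 * (ENNReal.ofReal (l * M) ^ 2 * volume {x | x ∈ K ∧ l * M ≤ inner ℝ x θ}) := by ring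
      _ ≤ 4 * (volume K * σ ^ 2) := by gcongr
      _ = _ := by ring
  have h6 : ENNReal.ofReal (l * M) ≤ 2 * σ :=
    (ENNReal.pow_le_pow_left_iff two_ne_zero).1 h5
  have h7 : l * M ≤ 2 * σ := by
    rw [show (2 * σ : ℝ≥0∞) = ENNReal.ofReal (2 * σ) by
      rw [ENNReal.ofReal_mul (by norm_num)]; simp] at h6
    exact (ENNReal.ofReal_le_ofReal_iff (by positivity)).1 h6
  rw [← NNReal.coe_le_coe]
  push_cast
  rw [Real.norm_of_nonneg hpos]
  calc M = 2 * n * (l * M) := by rw [hl]; field_simp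
    _ ≤ 2 * n * (2 * σ) := by gcongr
    _ = _ := by ring

theorem lintegral_inner_normalized (h0 : volume K ≠ 0) (h1 : volume K ≠ ⊤) {σ : ℝ≥0} (hσ : 0 < σ)
    {p : ℝ} (hp : 0 < p) :
    (∫⁻ x, (((‖inner ℝ x θ‖₊ / σ : ℝ≥0)) : ℝ≥0∞) ^ p ∂((volume K)⁻¹ • volume.restrict K)) *
      (volume K * (σ : ℝ≥0∞) ^ p) = ∫⁻ x in K, ‖inner ℝ x θ‖ₑ ^ p := by
  rw [lintegral_smul_measure, smul_eq_mul]
  have e : ∀ x : E n, (((‖inner ℝ x θ‖₊ / σ : ℝ≥0)) : ℝ≥0∞) ^ p = ‖inner ℝ x θ‖ₑ ^ p * (σ ^ p : ℝ≥0∞)⁻¹ := by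
    intro x
    rw [ENNReal.coe_div hσ.ne', ENNReal.div_rpow_of_nonneg _ _ hp.le, div_eq_mul_inv]
    rfl
  have hσp : (σ : ℝ≥0∞) ^ p ≠ 0 := by simp [hσ.ne']
  have hσp' : (σ : ℝ≥0∞) ^ p ≠ ⊤ := by simp [hp.le]
  simp_rw [e]
  rw [lintegral_mul_const' _ _ (by simpa using hσp)]
  set I := ∫⁻ x in K, ‖inner ℝ x θ‖ₑ ^ p
  calc (volume K)⁻¹ * (I * (σ ^ p : ℝ≥0∞)⁻¹) * (volume K * σ ^ p)
      = ((volume K)⁻¹ * volume K) * ((σ ^ p : ℝ≥0∞)⁻¹ * σ ^ p) * I := by ring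
    _ = I := by
      rw [ENNReal.inv_mul_cancel h0 h1, ENNReal.inv_mul_cancel hσp hσp', one_mul, one_mul]

theorem isProbabilityMeasure_normalized (h0 : volume K ≠ 0) (h1 : volume K ≠ ⊤) :
    IsProbabilityMeasure ((volume K)⁻¹ • volume.restrict K) :=
  ⟨by rw [Measure.smul_apply, Measure.restrict_apply_univ, smul_eq_mul,
    ENNReal.inv_mul_cancel h0 h1]⟩

theorem lintegral_inner_normalized_sq (h0 : volume K ≠ 0) (h1 : volume K ≠ ⊤) {σ : ℝ≥0} (hσ : 0 < σ)
    (h2 : ∫⁻ x in K, ‖inner ℝ x θ‖ₑ ^ 2 = volume K * σ ^ 2) :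
    ∫⁻ x, ((‖inner ℝ x θ‖₊ / σ : ℝ≥0) : ℝ≥0∞) ^ 2 ∂((volume K)⁻¹ • volume.restrict K) = 1 := by
  have h := lintegral_inner_normalized (θ := θ) h0 h1 hσ (p := 2) (by norm_num)
  simp only [ENNReal.rpow_ofNat] at h
  rw [h2] at h
  have hne : volume K * (σ : ℝ≥0∞) ^ 2 ≠ 0 := by simp [h0, hσ.ne']
  have hne' : volume K * (σ : ℝ≥0∞) ^ 2 ≠ ⊤ := ENNReal.mul_ne_top h1 (by simp)
  nth_rw 2 [← one_mul (volume K * (σ : ℝ≥0∞) ^ 2)] at h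
  exact (ENNReal.mul_left_inj hne hne').1 h

theorem le_lintegral_inner (hK : MeasurableSet K) (hc : Convex ℝ K)
    (hs : ∀ x ∈ K, -x ∈ K) (h0 : volume K ≠ 0) (h1 : volume K ≠ ⊤) (hθ : θ ≠ 0) {σ : ℝ≥0}
    (hσ : 0 < σ) (h2 : ∫⁻ x in K, ‖inner ℝ x θ‖ₑ ^ 2 = volume K * σ ^ 2) {p : ℝ} (hp : 0 < p) :
    volume K * σ ^ p ≤ 289 ^ p * ∫⁻ x in K, ‖inner ℝ x θ‖ₑ ^ p := by
  have := isProbabilityMeasure_normalized h0 h1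
  have h := (geometricTail_inner hK hc hs h0 h1 hθ hσ).one_le_mul_lintegral_rpow (by fun_prop)
    (lintegral_inner_normalized_sq h0 h1 hσ h2) hp
  rw [← lintegral_inner_normalized h0 h1 hσ hp, ← mul_assoc]
  exact le_mul_of_one_le_left' h

/-- Three regimes: comparison with the second moment for `p ≤ 1`, the exponential tail for `1 ≤ p ≤
n`, and the maximum bound `4nσ` for `p ≥ n`. The last one is why the constant stops growing at `n`.
-/
theorem lintegral_inner_le (hn : 1 ≤ n) (hK : MeasurableSet K) (hc : Convex ℝ K)
    (hs : ∀ x ∈ K, -x ∈ K) (h0 : volume K ≠ 0) (h1 : volume K ≠ ⊤) (hθ : θ ≠ 0) {σ : ℝ≥0}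
    (hσ : 0 < σ) (h2 : ∫⁻ x in K, ‖inner ℝ x θ‖ₑ ^ 2 = volume K * σ ^ 2) {p : ℝ} (hp : 0 < p) :
    ∫⁻ x in K, ‖inner ℝ x θ‖ₑ ^ p ≤
      volume K * σ ^ p * ENNReal.ofReal ((16 * max 1 (min p n)) ^ p) := by
  have := isProbabilityMeasure_normalized h0 h1
  have hsq := lintegral_inner_normalized_sq h0 h1 hσ h2
  have hn' : (1 : ℝ) ≤ n := by exact_mod_cast hn
  rcases le_total p 1 with hp1 | hp1
  · have h := lintegral_rpow_le_one_of_le_two (by fun_prop) hsq hp (by linarith)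
    rw [← lintegral_inner_normalized h0 h1 hσ hp, mul_comm]
    gcongr
    refine h.trans ?_
    rw [ENNReal.one_le_ofReal]
    refine Real.one_le_rpow ?_ hp.le
    linarith [le_max_left 1 (min p n)]
  rcases le_total p n with hpn | hpn
  · have h := (geometricTail_inner hK hc hs h0 h1 hθ hσ).lintegral_rpow_le (by fun_prop) hsq hp1
    rw [← lintegral_inner_normalized h0 h1 hσ hp, mul_comm, min_eq_left hpn, max_eq_right hp1]
    gcongr
  · rw [min_eq_right hpn, max_eq_right hn']
    calc ∫⁻ x in K, ‖inner ℝ x θ‖ₑ ^ p ≤ ∫⁻ x in K, ((4 * n * σ : ℝ≥0) : ℝ≥0∞) ^ p := by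
          refine setLIntegral_mono' hK fun x hx => ENNReal.rpow_le_rpow ?_ hp.le
          exact ENNReal.coe_le_coe.2 (inner_le_of_lintegral_sq hn hK hc hs h0 h1 hθ h2 hx)
      _ = volume K * σ ^ p * ENNReal.ofReal ((4 * n) ^ p) := by
          rw [setLIntegral_const, ENNReal.coe_mul, ENNReal.mul_rpow_of_nonneg _ _ hp.le,
            ← ENNReal.ofReal_rpow_of_nonneg (by positivity) hp.le, ENNReal.ofReal_mul (by norm_num)]
          push_cast
          simp only [ENNReal.ofReal_ofNat, ENNReal.ofReal_natCast]
          ring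
      _ ≤ _ := by
          gcongr
          norm_num

end

/-! ### Polar coordinates and Gaussian integrals. -/

theorem lintegral_polar {n : ℕ} (hn : 1 ≤ n) {f : E n → ℝ≥0∞} (hf : Measurable f) :
    ∫⁻ x, f x = ∫⁻ u : sphere (0 : E n) 1, (∫⁻ r in Set.Ioi (0 : ℝ),
      ENNReal.ofReal (r ^ (n - 1)) * f (r • (u : E n))) ∂(volume : Measure (E n)).toSphere := by
  have : Nonempty (Fin n) := ⟨⟨0, hn⟩⟩
  have hmp := (volume : Measure (E n)).measurePreserving_homeomorphUnitSphereProd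
  have hfr : Module.finrank ℝ (E n) = n := by simp
  have h1 : ∫⁻ x, f x = ∫⁻ x : ({0}ᶜ : Set (E n)), f x ∂((volume : Measure (E n)).comap (↑)) := by
    rw [lintegral_subtype_comap (measurableSet_singleton _).compl]
    simp
  have hm : Measurable fun q : sphere (0 : E n) 1 × Set.Ioi (0 : ℝ) => f ((q.2 : ℝ) • (q.1 : E n)) := by
    fun_prop
  have h2 : ∀ x : ({0}ᶜ : Set (E n)), f x =
      (fun q : sphere (0 : E n) 1 × Set.Ioi (0 : ℝ) => f ((q.2 : ℝ) • (q.1 : E n)))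
        (homeomorphUnitSphereProd (E n) x) := by
    intro x
    have hx : ‖(x : E n)‖ ≠ 0 := norm_ne_zero_iff.2 x.2
    simp [smul_smul, hx]
  rw [h1, lintegral_congr h2, hmp.lintegral_comp hm, lintegral_prod _ hm.aemeasurable]
  refine lintegral_congr fun u => ?_
  have hm' : Measurable fun r : Set.Ioi (0 : ℝ) => f ((r : ℝ) • (u : E n)) := by fun_prop
  rw [Measure.volumeIoiPow, lintegral_withDensity_eq_lintegral_mul _ (by fun_prop) hm', hfr]
  exact lintegral_subtype_comap measurableSet_Ioi
    (fun r : ℝ => ENNReal.ofReal (r ^ (n - 1)) * f (r • (u : E n)))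

theorem ofReal_pow_mul_rpow {n : ℕ} (hn : 1 ≤ n) {p r : ℝ} (hp : 0 ≤ p) (hr : 0 < r) :
    ENNReal.ofReal (r ^ (n - 1)) * ENNReal.ofReal r ^ p = ENNReal.ofReal (r ^ (n + p - 1)) := by
  rw [ENNReal.ofReal_rpow_of_nonneg hr.le hp, ← ENNReal.ofReal_mul (by positivity), ← Real.rpow_natCast,
    ← Real.rpow_add hr, Nat.cast_sub hn]
  congr 2
  push_cast
  ring

theorem lintegral_rpow_Ioc {q ρ : ℝ} (hq : 0 < q) (hρ : 0 ≤ ρ) :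
    ∫⁻ r in Set.Ioc 0 ρ, ENNReal.ofReal (r ^ (q - 1)) = ENNReal.ofReal (ρ ^ q / q) := by
  rw [← ofReal_integral_eq_lintegral_ofReal
    ((intervalIntegral.intervalIntegrable_rpow' (by linarith)).1)]
  · rw [← intervalIntegral.integral_of_le hρ, integral_rpow (Or.inl (by linarith))]
    simp [hq.ne']
  · filter_upwards [ae_restrict_mem measurableSet_Ioc] with r hr
    exact Real.rpow_nonneg hr.1.le _

theorem lintegral_rpow_mul_exp_neg_sq {q : ℝ} (hq : 0 < q) :
    ∫⁻ r in Set.Ioi (0 : ℝ), ENNReal.ofReal (r ^ (q - 1) * Real.exp (-r ^ (2 : ℝ))) =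
      ENNReal.ofReal (Real.Gamma (q / 2) / 2) := by
  have h := integral_rpow_mul_exp_neg_rpow (p := 2) (q := q - 1) (by norm_num) (by linarith)
  have hpos : 0 < Real.Gamma (q / 2) := Real.Gamma_pos_of_pos (by positivity)
  rw [sub_add_cancel] at h
  rw [← ofReal_integral_eq_lintegral_ofReal, h]
  · congr 1
    ring
  · refine Integrable.of_integral_ne_zero ?_
    rw [h]
    positivity
  · filter_upwards [ae_restrict_mem measurableSet_Ioi] with r hr
    have : (0 : ℝ) < r := hr
    positivity

section
variable {n : ℕ} {p : ℝ} {g : E n → ℝ≥0∞}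

/-- Along each ray the integrand is `r^{n+p-1}`, integrated up to `ρ u`. The function `ρ` is left
free so that the same formula serves a ball (constant `ρ`) and a convex body (inverse gauge). -/
theorem lintegral_homogeneous_body (hn : 1 ≤ n) (hp : 0 ≤ p) (hg : Measurable g)
    (hom : ∀ (r : ℝ), 0 < r → ∀ x, g (r • x) = ENNReal.ofReal r ^ p * g x) {K : Set (E n)}
    (hK : MeasurableSet K) {ρ : E n → ℝ} (hρ0 : ∀ u, 0 ≤ ρ u)
    (hρ : ∀ u ∈ sphere (0 : E n) 1, ∀ r : ℝ, 0 < r → (r • u ∈ K ↔ r ≤ ρ u)) :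
    ∫⁻ x in K, g x = ∫⁻ u : sphere (0 : E n) 1, g u * ENNReal.ofReal (ρ u ^ (n + p) / (n + p))
      ∂(volume : Measure (E n)).toSphere := by
  have hnp : 0 < (n : ℝ) + p := by
    have : (1 : ℝ) ≤ n := by exact_mod_cast hn
    linarith
  rw [← lintegral_indicator hK, lintegral_polar hn (hg.indicator hK)]
  refine lintegral_congr fun u => ?_
  rw [← lintegral_rpow_Ioc hnp (hρ0 u), mul_comm, ← lintegral_mul_const _ (by fun_prop),
    ← Set.Ioi_inter_Iic, Set.inter_comm, ← setLIntegral_indicator measurableSet_Iic]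
  refine setLIntegral_congr_fun measurableSet_Ioi fun r hr => ?_
  have hr' : 0 < r := hr
  have hm := hρ u u.2 r hr'
  by_cases h : r ≤ ρ u
  · rw [Set.indicator_of_mem (hm.2 h), Set.indicator_of_mem (Set.mem_Iic.2 h), hom r hr',
      ← mul_assoc, ofReal_pow_mul_rpow hn hp hr']
  · rw [Set.indicator_of_notMem (mt hm.1 h), Set.indicator_of_notMem (mt Set.mem_Iic.1 h)]
    simp

theorem lintegral_homogeneous_gaussian (hn : 1 ≤ n) (hp : 0 ≤ p) (hg : Measurable g)
    (hom : ∀ (r : ℝ), 0 < r → ∀ x, g (r • x) = ENNReal.ofReal r ^ p * g x) :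
    ∫⁻ x, g x * ENNReal.ofReal (Real.exp (-‖x‖ ^ 2)) =
      (∫⁻ u : sphere (0 : E n) 1, g u ∂(volume : Measure (E n)).toSphere) *
        ENNReal.ofReal (Real.Gamma ((n + p) / 2) / 2) := by
  have hnp : 0 < (n : ℝ) + p := by
    have : (1 : ℝ) ≤ n := by exact_mod_cast hn
    linarith
  rw [lintegral_polar hn (by fun_prop), ← lintegral_mul_const _ (by fun_prop)]
  refine lintegral_congr fun u => ?_
  rw [← lintegral_rpow_mul_exp_neg_sq hnp, ← lintegral_const_mul _ (by fun_prop)]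
  refine setLIntegral_congr_fun measurableSet_Ioi fun r hr => ?_
  have hr' : 0 < r := hr
  have hu : ‖(u : E n)‖ = 1 := by simp
  simp only [hom r hr', norm_smul, hu, mul_one, Real.norm_of_nonneg hr'.le, Real.rpow_two]
  rw [ENNReal.ofReal_mul (by positivity), ← ofReal_pow_mul_rpow hn hp hr']
  ring

end

theorem lintegral_abs_rpow_gaussian {p : ℝ} (hp : 0 ≤ p) :
    ∫⁻ t : ℝ, ‖t‖ₑ ^ p * ENNReal.ofReal (Real.exp (-t ^ 2)) =
      ENNReal.ofReal (Real.Gamma ((p + 1) / 2)) := by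
  have h := integral_rpow_mul_exp_neg_rpow (p := 2) (q := p) (by norm_num) (by linarith)
  have hpos : 0 < Real.Gamma ((p + 1) / 2) := Real.Gamma_pos_of_pos (by positivity)
  have h' : ∫ t : ℝ, |t| ^ p * Real.exp (-|t| ^ (2 : ℝ)) = Real.Gamma ((p + 1) / 2) := by
    rw [integral_comp_abs (f := fun t => t ^ p * Real.exp (-t ^ (2 : ℝ))), h]
    ring
  rw [← h', ofReal_integral_eq_lintegral_ofReal]
  · refine lintegral_congr fun t => ?_
    rw [ENNReal.ofReal_mul (by positivity), ← ENNReal.ofReal_rpow_of_nonneg (abs_nonneg _) hp,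
      Real.rpow_two, sq_abs, Real.enorm_eq_ofReal_abs]
  · refine Integrable.of_integral_ne_zero ?_
    rw [h']
    positivity
  · exact Filter.Eventually.of_forall fun t => by positivity

theorem lintegral_gaussian_pi (m : ℕ) :
    ∫⁻ v : Fin m → ℝ, ENNReal.ofReal (Real.exp (-∑ i, v i ^ 2)) = ENNReal.ofReal (√Real.pi ^ m) := by
  induction m with
  | zero => simp [lintegral_unique, volume_pi]
  | succ m ih =>
    have h := lintegral_abs_rpow_gaussian (p := 0) le_rfl
    rw [zero_add, Real.Gamma_one_half_eq] at h
    simp only [ENNReal.rpow_zero, one_mul] at h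
    rw [lintegral_pi_succ (by fun_prop), pow_succ', ENNReal.ofReal_mul (by positivity), ← ih, ← h,
      ← lintegral_mul_const _ (by fun_prop)]
    refine lintegral_congr fun s => ?_
    rw [← lintegral_const_mul _ (by fun_prop)]
    refine lintegral_congr fun v => ?_
    rw [← ENNReal.ofReal_mul (by positivity), ← Real.exp_add, Fin.sum_univ_succ]
    simp only [Fin.cons_zero, Fin.cons_succ, neg_add]

/-- Rotating `θ` to a coordinate vector leaves the Gaussian invariant and splits the integral into a
product of one-dimensional ones. -/
theorem lintegral_inner_rpow_gaussian {n : ℕ} (hn : 1 ≤ n) {p : ℝ} (hp : 0 ≤ p) {θ : E n}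
    (hθ : ‖θ‖ = 1) :
    ∫⁻ x : E n, ‖inner ℝ x θ‖ₑ ^ p * ENNReal.ofReal (Real.exp (-‖x‖ ^ 2)) =
      ENNReal.ofReal (Real.Gamma ((p + 1) / 2) * √Real.pi ^ (n - 1)) := by
  obtain ⟨m, rfl⟩ : ∃ m, n = m + 1 := ⟨n - 1, by omega⟩
  obtain ⟨b, hb⟩ := Orthonormal.exists_orthonormalBasis_extension_of_card_eq (𝕜 := ℝ) (E := E (m + 1))
    (ι := Fin (m + 1)) (by simp) (v := fun _ => θ) (s := {0}) (by
      rw [orthonormal_iff_ite]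
      rintro ⟨i, hi⟩ ⟨j, hj⟩
      obtain rfl := hi
      obtain rfl := hj
      simp [hθ])
  have hb0 : b 0 = θ := hb 0 rfl
  have mp := b.measurePreserving_repr
  have mp' := PiLp.volume_preserving_toLp (Fin (m + 1))
  have e1 : ∀ x : E (m + 1), ‖inner ℝ x θ‖ₑ ^ p * ENNReal.ofReal (Real.exp (-‖x‖ ^ 2)) =
      (fun y : E (m + 1) => ‖y 0‖ₑ ^ p * ENNReal.ofReal (Real.exp (-‖y‖ ^ 2))) (b.repr x) := by
    intro x
    simp only [b.repr_apply_apply, hb0, LinearIsometryEquiv.norm_map, real_inner_comm]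
  have hm : Measurable fun y : E (m + 1) =>
      ‖y 0‖ₑ ^ p * ENNReal.ofReal (Real.exp (-‖y‖ ^ 2)) := by fun_prop
  rw [lintegral_congr e1, mp.lintegral_comp hm, ← mp'.lintegral_comp (by fun_prop),
    lintegral_pi_succ (by fun_prop), ENNReal.ofReal_mul (Real.Gamma_nonneg_of_nonneg (by positivity)),
    Nat.add_sub_cancel, ← lintegral_gaussian_pi m, ← lintegral_abs_rpow_gaussian hp,
    ← lintegral_mul_const _ (by fun_prop)]
  refine lintegral_congr fun s => ?_
  rw [← lintegral_const_mul _ (by fun_prop)]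
  refine lintegral_congr fun v => ?_
  rw [mul_assoc, ← ENNReal.ofReal_mul (by positivity), ← Real.exp_add, EuclideanSpace.norm_sq_eq,
    Fin.sum_univ_succ]
  simp [add_comm]

theorem enorm_inner_smul_rpow {n : ℕ} {p : ℝ} (hp : 0 ≤ p) (θ : E n) (r : ℝ) (hr : 0 < r) (x : E n) :
    ‖inner ℝ (r • x) θ‖ₑ ^ p = ENNReal.ofReal r ^ p * ‖inner ℝ x θ‖ₑ ^ p := by
  rw [real_inner_smul_left, enorm_mul, ENNReal.mul_rpow_of_nonneg _ _ hp, Real.enorm_of_nonneg hr.le]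

/-- The spherical integral of `|⟨u, θ⟩|^p` is found by computing the Gaussian integral both in
product form and in polar form, then inserted into the polar formula for the ball. -/
theorem lintegral_inner_rpow_closedBall {n : ℕ} (hn : 1 ≤ n) {p : ℝ} (hp : 0 ≤ p) {θ : E n}
    (hθ : ‖θ‖ = 1) {R : ℝ} (hR : 0 ≤ R) :
    ∫⁻ x in closedBall (0 : E n) R, ‖inner ℝ x θ‖ₑ ^ p =
      ENNReal.ofReal (R ^ (n + p) * (Real.Gamma ((p + 1) / 2) * √Real.pi ^ (n - 1)) /
        Real.Gamma ((n + p) / 2 + 1)) := by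
  have hnp : 0 < (n : ℝ) + p := by
    have : (1 : ℝ) ≤ n := by exact_mod_cast hn
    linarith
  have hG : 0 < Real.Gamma ((n + p) / 2) := Real.Gamma_pos_of_pos (by positivity)
  have hm : Measurable fun x : E n => ‖inner ℝ x θ‖ₑ ^ p := by fun_prop
  have h1 := lintegral_homogeneous_gaussian hn hp hm (enorm_inner_smul_rpow hp θ)
  rw [lintegral_inner_rpow_gaussian hn hp hθ] at h1
  rw [lintegral_homogeneous_body hn hp hm (enorm_inner_smul_rpow hp θ) measurableSet_closedBall
    (ρ := fun _ => R) (fun _ => hR)]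
  · rw [lintegral_mul_const _ (by fun_prop)]
    set J := ∫⁻ u : sphere (0 : E n) 1, ‖inner ℝ (u : E n) θ‖ₑ ^ p ∂(volume : Measure (E n)).toSphere
    have hJ : J = ENNReal.ofReal (Real.Gamma ((p + 1) / 2) * √Real.pi ^ (n - 1) /
        (Real.Gamma ((n + p) / 2) / 2)) := by
      rw [ENNReal.ofReal_div_of_pos (by positivity), h1, ENNReal.mul_div_cancel_right]
      · simp [hG]
      · simp
    rw [hJ, ← ENNReal.ofReal_mul (by positivity), Real.Gamma_add_one (by positivity)]
    congr 1
    field_simp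
  · intro u hu r hr
    have : ‖u‖ = 1 := by simpa using hu
    simp [norm_smul, this, abs_of_pos hr]

/-! ### Estimates for the Gamma function. -/

/-- By convexity of `log Γ`, its slope on `[x, x + a]` is at most its slope on `[x + a, x + a + 1]`,
which is `log (x + a)`. -/
theorem Gamma_add_le {x a : ℝ} (hx : 0 < x) (ha : 0 ≤ a) :
    Real.Gamma (x + a) ≤ Real.Gamma x * (x + a) ^ a := by
  rcases ha.eq_or_lt with rfl | ha
  · simp
  have h := Real.convexOn_log_Gamma.slope_mono_adjacent (x := x) (y := x + a) (z := x + a + 1)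
    hx (by simp only [Set.mem_Ioi]; positivity) (by linarith) (by linarith)
  have g1 := Real.Gamma_pos_of_pos hx
  have g2 := Real.Gamma_pos_of_pos (show 0 < x + a by positivity)
  simp only [Function.comp] at h
  rw [Real.Gamma_add_one (by positivity), Real.log_mul (by positivity) (by positivity)] at h
  simp only [add_sub_cancel_left, add_sub_cancel_right, div_one] at h
  rw [div_le_iff₀ ha] at h
  rw [← Real.log_le_log_iff g2 (by positivity), Real.log_mul (by positivity) (by positivity),
    Real.log_rpow (by positivity)]
  linarith

theorem le_Gamma_add {x y a : ℝ} (hy : 0 < y) (hyx : y < x) (ha : 0 ≤ a) :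
    Real.Gamma x * (Real.Gamma x / Real.Gamma y) ^ (a / (x - y)) ≤ Real.Gamma (x + a) := by
  rcases ha.eq_or_lt with rfl | ha
  · simp
  have h := Real.convexOn_log_Gamma.slope_mono_adjacent (x := y) (y := x) (z := x + a)
    hy (by simp only [Set.mem_Ioi]; linarith) hyx (by linarith)
  have g0 := Real.Gamma_pos_of_pos hy
  have g1 := Real.Gamma_pos_of_pos (hy.trans hyx)
  have g2 := Real.Gamma_pos_of_pos (show 0 < x + a by linarith)
  have hxy : 0 < x - y := by linarith
  simp only [Function.comp] at h
  rw [add_sub_cancel_left, le_div_iff₀ ha] at h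
  rw [← Real.log_le_log_iff (by positivity) g2, Real.log_mul (by positivity) (by positivity),
    Real.log_rpow (by positivity), Real.log_div (by positivity) (by positivity)]
  have e : a / (x - y) * (Real.log (Real.Gamma x) - Real.log (Real.Gamma y)) =
      (Real.log (Real.Gamma x) - Real.log (Real.Gamma y)) / (x - y) * a := by ring
  linarith

/-- Keep only the part `x > s` of the Gamma integral, where `x ^ s ≥ s ^ s`. -/
theorem rpow_mul_exp_neg_le_Gamma {s : ℝ} (hs : 0 < s) :
    s ^ s * Real.exp (-s) ≤ Real.Gamma (s + 1) := by
  rw [Real.Gamma_eq_integral (by positivity), add_sub_cancel_right]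
  have hint := Real.GammaIntegral_convergent (s := s + 1) (by positivity)
  rw [add_sub_cancel_right] at hint
  have hsub : Set.Ioi s ⊆ Set.Ioi 0 := Set.Ioi_subset_Ioi hs.le
  calc s ^ s * Real.exp (-s) = ∫ x in Set.Ioi s, Real.exp (-x) * s ^ s := by
        rw [integral_mul_const, integral_exp_neg_Ioi, mul_comm]
    _ ≤ ∫ x in Set.Ioi s, Real.exp (-x) * x ^ s := by
        refine setIntegral_mono_on ((integrableOn_exp_neg_Ioi s).mul_const _) (hint.mono_set hsub)
          measurableSet_Ioi fun x hx => ?_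
        have : s < x := hx
        gcongr
    _ ≤ ∫ x in Set.Ioi 0, Real.exp (-x) * x ^ s := by
        refine setIntegral_mono_set hint ?_ hsub.eventuallyLE
        filter_upwards [ae_restrict_mem measurableSet_Ioi] with x hx
        have : (0 : ℝ) < x := hx
        positivity

theorem Gamma_half_add_le {p : ℝ} (hp : 0 < p) :
    Real.Gamma ((p + 1) / 2) ≤ √Real.pi * (max 1 p) ^ (p / 2) := by
  have h := Gamma_add_le (x := 1 / 2) (a := p / 2) (by norm_num) (by positivity)
  rw [Real.Gamma_one_half_eq] at h
  rw [show (p + 1) / 2 = 1 / 2 + p / 2 by ring]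
  refine h.trans ?_
  gcongr
  rcases le_total p 1 with h | h
  · rw [max_eq_left h]; linarith
  · rw [max_eq_right h]; linarith

theorem exists_le_Gamma_half_add :
    ∃ c : ℝ, 0 < c ∧ ∀ p : ℝ, 0 < p → √Real.pi * (c * max 1 p) ^ (p / 2) ≤ Real.Gamma ((p + 1) / 2) := by
  set κ := Real.Gamma (1 / 2) / Real.Gamma (1 / 4) with hκ
  have k1 : 0 < Real.Gamma (1 / 2) := Real.Gamma_pos_of_pos (by norm_num)
  have k2 : 0 < Real.Gamma (1 / 4) := Real.Gamma_pos_of_pos (by norm_num)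
  have hκ0 : 0 < κ := by positivity
  -- For `p ≤ 1` the slope of `log Γ` on `[1/4, 1/2]` gives `κ ^ 4` and is sharp at `p = 0`. For `p
  -- ≥ 1`, `exp (-5)` raised to `p/2` absorbs `√π ≤ e^p`, `√s ≤ e^{p/2}` and the Stirling factor,
  -- because `p/2 + p - 5p/2 = -p ≤ -s`; the `1/2` accounts for `p/2 ≤ s`.
  refine ⟨min (κ ^ (4 : ℝ)) (Real.exp (-5) / 2), by positivity, fun p hp => ?_⟩
  rcases le_total p 1 with h1 | h1
  · rw [max_eq_left h1, mul_one]
    have h := le_Gamma_add (x := 1 / 2) (y := 1 / 4) (a := p / 2) (by norm_num) (by norm_num)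
      (by positivity)
    rw [← hκ, Real.Gamma_one_half_eq] at h
    rw [show (p + 1) / 2 = 1 / 2 + p / 2 by ring]
    refine le_trans ?_ h
    rw [show p / 2 / (1 / 2 - 1 / 4) = 4 * (p / 2) by ring, Real.rpow_mul hκ0.le]
    gcongr
    exact min_le_left _ _
  · rw [max_eq_right h1]
    set s := (p + 1) / 2 with hs
    have hs1 : 1 ≤ s := by linarith
    have hsp : s ≤ p := by linarith
    have h := rpow_mul_exp_neg_le_Gamma (s := s) (by positivity)
    rw [Real.Gamma_add_one (by positivity)] at h
    refine le_of_mul_le_mul_left (le_trans ?_ h) (by positivity : 0 < s)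
    have hpi : √Real.pi ≤ Real.exp p := by
      have : √Real.pi ≤ 2 := by
        rw [Real.sqrt_le_left (by norm_num)]
        linarith [Real.pi_le_four]
      linarith [Real.add_one_le_exp p]
    have hrt : s ^ (1 / 2 : ℝ) ≤ Real.exp (p / 2) := by
      calc s ^ (1 / 2 : ℝ) ≤ (Real.exp p) ^ (1 / 2 : ℝ) := by
            gcongr
            linarith [Real.add_one_le_exp p]
        _ = Real.exp (p / 2) := by
            rw [← Real.exp_mul]
            congr 1
            ring
    have hq : min (κ ^ (4 : ℝ)) (Real.exp (-5) / 2) * p ≤ Real.exp (-5) * s := by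
      calc min (κ ^ (4 : ℝ)) (Real.exp (-5) / 2) * p ≤ Real.exp (-5) / 2 * p := by
            gcongr
            exact min_le_right _ _
        _ = Real.exp (-5) * (p / 2) := by ring
        _ ≤ _ := by
            gcongr
            linarith
    calc s * (√Real.pi * (min (κ ^ (4 : ℝ)) (Real.exp (-5) / 2) * p) ^ (p / 2))
        ≤ s * (Real.exp p * (Real.exp (-5) * s) ^ (p / 2)) := by
          exact mul_le_mul_of_nonneg_left (mul_le_mul hpi
            (Real.rpow_le_rpow (by positivity) hq (by positivity)) (by positivity) (by positivity))
            (by positivity)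
      _ = s ^ (1 / 2 : ℝ) * (s ^ (1 / 2 : ℝ) * s ^ (p / 2)) * Real.exp (p + -5 * (p / 2)) := by
          rw [Real.mul_rpow (by positivity) (by positivity), ← Real.exp_mul, Real.exp_add,
            ← mul_assoc (s ^ (1 / 2 : ℝ)), ← Real.rpow_add (by positivity)]
          norm_num
          ring
      _ ≤ Real.exp (p / 2) * (s ^ (1 / 2 : ℝ) * s ^ (p / 2)) * Real.exp (p + -5 * (p / 2)) := by
          gcongr
      _ = s ^ s * Real.exp (p / 2 + (p + -5 * (p / 2))) := by
          rw [← Real.rpow_add (by positivity), Real.exp_add (p / 2), show (1 / 2 + p / 2 : ℝ) = s by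
            rw [hs]; ring]
          ring
      _ ≤ s ^ s * Real.exp (-s) := by
          gcongr
          linarith

/-! ### Volume and moments of the Euclidean ball. -/

section
variable {n : ℕ} {R : ℝ}

theorem volume_closedBall_eq (hn : 1 ≤ n) (hR : 0 < R) :
    volume (closedBall (0 : E n) R) =
      ENNReal.ofReal (R ^ (n : ℝ) * √Real.pi ^ n / Real.Gamma (n / 2 + 1)) := by
  obtain ⟨m, rfl⟩ : ∃ m, n = m + 1 := ⟨n - 1, by omega⟩
  have h := lintegral_inner_rpow_closedBall hn (p := 0) le_rfl
    (θ := EuclideanSpace.single (0 : Fin (m + 1)) (1 : ℝ)) (by simp) hR.le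
  simp only [ENNReal.rpow_zero, add_zero, zero_add, Real.Gamma_one_half_eq, lintegral_one,
    Measure.restrict_apply_univ, Nat.add_sub_cancel] at h
  rw [h, pow_succ']

/-- The volume formula says `(π R²)^{n/2} = (v²)^{n/2} Γ(n/2 + 1)`, and `Γ(n/2 + 1)` lies between
`(n/(2e))^{n/2}` and `(n/2 + 1)^{n/2}`. -/
theorem radius_sq_bounds (hn : 1 ≤ n) (hR : 0 < R) {v : ℝ} (hv : 0 < v)
    (hV : volume (closedBall (0 : E n) R) = ENNReal.ofReal (v ^ (n : ℝ))) :
    n / (2 * Real.exp 1 * Real.pi) * v ^ 2 ≤ R ^ 2 ∧ R ^ 2 ≤ n / 2 * v ^ 2 := by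
  have hn' : (1 : ℝ) ≤ n := by exact_mod_cast hn
  have hG : 0 < Real.Gamma (n / 2 + 1) := Real.Gamma_pos_of_pos (by positivity)
  have hpi := Real.pi_pos
  rw [volume_closedBall_eq hn hR, ENNReal.ofReal_eq_ofReal_iff (by positivity) (by positivity)] at hV
  have e : (R ^ 2 * Real.pi) ^ (n / 2 : ℝ) = (v ^ 2) ^ (n / 2 : ℝ) * Real.Gamma (n / 2 + 1) := by
    rw [Real.mul_rpow (by positivity) (by positivity), ← Real.rpow_natCast R 2, ← Real.rpow_natCast v 2,
      ← Real.rpow_mul hR.le, ← Real.rpow_mul hv.le]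
    rw [div_eq_iff hG.ne', ← Real.rpow_natCast (√Real.pi), Real.sqrt_eq_rpow, ← Real.rpow_mul hpi.le] at hV
    convert hV using 3 <;> push_cast <;> ring
  have hn2 : (0 : ℝ) < n / 2 := by positivity
  constructor
  · have h := rpow_mul_exp_neg_le_Gamma hn2
    have h' : (n / 2 * Real.exp (-1) * v ^ 2) ^ (n / 2 : ℝ) ≤ (R ^ 2 * Real.pi) ^ (n / 2 : ℝ) := by
      rw [e, Real.mul_rpow (by positivity) (by positivity), mul_comm,
        Real.mul_rpow (by positivity) (by positivity), ← Real.exp_mul]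
      gcongr
      simpa using h
    rw [Real.rpow_le_rpow_iff (by positivity) (by positivity) hn2, Real.exp_neg] at h'
    calc _ = n / 2 * (Real.exp 1)⁻¹ * v ^ 2 / Real.pi := by field_simp
      _ ≤ R ^ 2 * Real.pi / Real.pi := by gcongr
      _ = _ := by field_simp
  · have h := Gamma_add_le (x := 1) (a := n / 2) one_pos hn2.le
    rw [Real.Gamma_one, one_mul, add_comm] at h
    have h' : (R ^ 2 * Real.pi) ^ (n / 2 : ℝ) ≤ ((n / 2 + 1) * v ^ 2) ^ (n / 2 : ℝ) := by
      rw [e, mul_comm, Real.mul_rpow (by positivity) (by positivity)]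
      gcongr
    rw [Real.rpow_le_rpow_iff (by positivity) (by positivity) hn2] at h'
    have h3 := Real.pi_gt_three
    have : R ^ 2 * 3 ≤ (n / 2 + 1) * v ^ 2 := le_trans (by gcongr) h'
    have : (n / 2 + 1) * v ^ 2 ≤ (3 * n / 2) * v ^ 2 := by
      gcongr
      linarith
    linarith

theorem lintegral_inner_closedBall_eq (hn : 1 ≤ n) (hR : 0 < R) {p : ℝ} (hp : 0 < p) {θ : E n}
    (hθ : ‖θ‖ = 1) :
    ∫⁻ x in closedBall (0 : E n) R, ‖inner ℝ x θ‖ₑ ^ p =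
      volume (closedBall (0 : E n) R) * ENNReal.ofReal ((R ^ 2) ^ (p / 2) *
        (Real.Gamma ((p + 1) / 2) / √Real.pi *
          (Real.Gamma (n / 2 + 1) / Real.Gamma (n / 2 + 1 + p / 2)))) := by
  have hG : 0 < Real.Gamma (n / 2 + 1) := Real.Gamma_pos_of_pos (by positivity)
  have hpi := Real.pi_pos
  rw [lintegral_inner_rpow_closedBall hn hp.le hθ hR.le, volume_closedBall_eq hn hR,
    ← ENNReal.ofReal_mul (by positivity), ← Real.rpow_natCast R 2, ← Real.rpow_mul hR.le,
    Real.rpow_add hR, show ((2 : ℕ) : ℝ) * (p / 2) = p by push_cast; ring,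
    show (n + p) / 2 + 1 = n / 2 + 1 + p / 2 by ring]
  obtain ⟨m, rfl⟩ : ∃ m, n = m + 1 := ⟨n - 1, by omega⟩
  congr 1
  rw [Nat.add_sub_cancel, pow_succ]
  field_simp

/-- For `p ≤ n` the factor `n/2` in `R² ≤ (n/2) v²` cancels against the Gamma quotient, which is at
most `(2/n)^{p/2}`. For `p ≥ n` the trivial bound `|⟨x, θ⟩| ≤ R` is enough. -/
theorem lintegral_inner_closedBall_le (hn : 1 ≤ n) (hR : 0 < R) {v : ℝ} (hv : 0 < v)
    (hV : volume (closedBall (0 : E n) R) = ENNReal.ofReal (v ^ (n : ℝ))) {p : ℝ} (hp : 0 < p)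
    {θ : E n} (hθ : ‖θ‖ = 1) :
    ∫⁻ x in closedBall (0 : E n) R, ‖inner ℝ x θ‖ₑ ^ p ≤
      volume (closedBall (0 : E n) R) * ENNReal.ofReal ((√(max 1 (min p n)) * v) ^ p) := by
  have hn' : (1 : ℝ) ≤ n := by exact_mod_cast hn
  have hR2 := (radius_sq_bounds hn hR hv hV).2
  have e : (√(max 1 (min p n)) * v) ^ p = (max 1 (min p n) * v ^ 2) ^ (p / 2) := by
    rw [← Real.sqrt_sq hv.le, ← Real.sqrt_mul (by positivity), Real.sqrt_eq_rpow,
      ← Real.rpow_mul (by positivity), Real.sqrt_sq hv.le]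
    congr 1
    ring
  rw [e]
  rcases le_total p n with hpn | hpn
  · rw [lintegral_inner_closedBall_eq hn hR hp hθ, min_eq_left hpn]
    gcongr
    have h1 := Gamma_half_add_le hp
    have h2 := le_Gamma_add (x := n / 2 + 1) (y := n / 2) (a := p / 2) (by positivity) (by linarith)
      (by positivity)
    have hG : 0 < Real.Gamma (n / 2) := Real.Gamma_pos_of_pos (by positivity)
    have hG' : 0 < Real.Gamma (n / 2 + 1) := Real.Gamma_pos_of_pos (by positivity)
    have hG'' : 0 < Real.Gamma (n / 2 + 1 + p / 2) := Real.Gamma_pos_of_pos (by positivity)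
    have hr : Real.Gamma (n / 2 + 1) / Real.Gamma (n / 2) = n / 2 := by
      rw [Real.Gamma_add_one (by positivity)]
      field_simp
    rw [hr, add_sub_cancel_left, div_one] at h2
    have h3 : Real.Gamma ((p + 1) / 2) / √Real.pi ≤ (max 1 p) ^ (p / 2) := by
      rw [div_le_iff₀ (by positivity), mul_comm]
      exact h1
    have h4 : Real.Gamma (n / 2 + 1) / Real.Gamma (n / 2 + 1 + p / 2) ≤ (2 / n : ℝ) ^ (p / 2) := by
      rw [div_le_iff₀ hG'']
      calc Real.Gamma (n / 2 + 1) = (2 / n : ℝ) ^ (p / 2) * (Real.Gamma (n / 2 + 1) * (n / 2 : ℝ) ^ (p / 2)) := by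
            rw [mul_left_comm, ← Real.mul_rpow (by positivity) (by positivity)]
            rw [show (2 / n : ℝ) * (n / 2) = 1 by field_simp, Real.one_rpow, mul_one]
        _ ≤ _ := by gcongr
    calc (R ^ 2) ^ (p / 2) * (Real.Gamma ((p + 1) / 2) / √Real.pi *
          (Real.Gamma (n / 2 + 1) / Real.Gamma (n / 2 + 1 + p / 2)))
        ≤ (n / 2 * v ^ 2) ^ (p / 2) * ((max 1 p) ^ (p / 2) * (2 / n : ℝ) ^ (p / 2)) := by gcongr
      _ = _ := by
        rw [← Real.mul_rpow (by positivity) (by positivity), ← Real.mul_rpow (by positivity) (by positivity)]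
        congr 1
        field_simp
  · rw [min_eq_right hpn, max_eq_right hn']
    calc ∫⁻ x in closedBall (0 : E n) R, ‖inner ℝ x θ‖ₑ ^ p
        ≤ ∫⁻ x in closedBall (0 : E n) R, ENNReal.ofReal ((R ^ 2) ^ (p / 2)) := by
          refine setLIntegral_mono' measurableSet_closedBall fun x hx => ?_
          have h1 : ‖inner ℝ x θ‖ ≤ R := by
            refine (norm_inner_le_norm x θ).trans ?_
            rw [hθ, mul_one]
            simpa using hx
          rw [← ofReal_norm, ENNReal.ofReal_rpow_of_nonneg (norm_nonneg _) hp.le,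
            ← Real.rpow_natCast R 2, ← Real.rpow_mul hR.le,
            show ((2 : ℕ) : ℝ) * (p / 2) = p by push_cast; ring]
          gcongr
      _ ≤ _ := by
          rw [setLIntegral_const, mul_comm]
          gcongr
          nlinarith [sq_nonneg v]

theorem exists_le_lintegral_inner_closedBall :
    ∃ c : ℝ, 0 < c ∧ ∀ (n : ℕ), 1 ≤ n → ∀ (R : ℝ), 0 < R → ∀ v : ℝ, 0 < v →
      volume (closedBall (0 : E n) R) = ENNReal.ofReal (v ^ (n : ℝ)) → ∀ p : ℝ, 0 < p →
      ∀ θ : E n, ‖θ‖ = 1 →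
      volume (closedBall (0 : E n) R) * ENNReal.ofReal ((c * √(max 1 (min p n)) * v) ^ p) ≤
        ∫⁻ x in closedBall (0 : E n) R, ‖inner ℝ x θ‖ₑ ^ p := by
  obtain ⟨c, hc, hcG⟩ := exists_le_Gamma_half_add
  refine ⟨√(c / (4 * Real.exp 1 * Real.pi)), by positivity, ?_⟩
  intro n hn R hR v hv hV p hp θ hθ
  have hn' : (1 : ℝ) ≤ n := by exact_mod_cast hn
  have hR2 := (radius_sq_bounds hn hR hv hV).1
  have hpi := Real.pi_pos
  have e : (√(c / (4 * Real.exp 1 * Real.pi)) * √(max 1 (min p n)) * v) ^ p =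
      (c / (4 * Real.exp 1 * Real.pi) * max 1 (min p n) * v ^ 2) ^ (p / 2) := by
    rw [← Real.sqrt_mul (by positivity)]
    nth_rw 1 [← Real.sqrt_sq hv.le]
    rw [← Real.sqrt_mul (by positivity), Real.sqrt_eq_rpow, ← Real.rpow_mul (by positivity)]
    congr 1
    ring
  rw [e, lintegral_inner_closedBall_eq hn hR hp hθ]
  gcongr
  have h2 := Gamma_add_le (x := n / 2 + 1) (a := p / 2) (by positivity) (by positivity)
  have hG' : 0 < Real.Gamma (n / 2 + 1) := Real.Gamma_pos_of_pos (by positivity)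
  have hG'' : 0 < Real.Gamma (n / 2 + 1 + p / 2) := Real.Gamma_pos_of_pos (by positivity)
  have h3 : (c * max 1 p) ^ (p / 2) ≤ Real.Gamma ((p + 1) / 2) / √Real.pi := by
    rw [le_div_iff₀ (by positivity), mul_comm]
    exact hcG p hp
  set w : ℝ := n / 2 + 1 + p / 2 with hw
  have hw0 : 0 < w := by positivity
  have h4 : (1 / w) ^ (p / 2) ≤ Real.Gamma (n / 2 + 1) / Real.Gamma w := by
    rw [le_div_iff₀ hG'', Real.div_rpow (by norm_num) hw0.le, Real.one_rpow, one_div_mul_eq_div,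
      div_le_iff₀ (by positivity)]
    exact h2
  -- Here the two regimes merge: `w ≤ 2n` when `p ≤ n`, and `w ≤ 2p` when `p ≥ n`.
  have hm : max 1 (min p n) / (2 * n) ≤ max 1 p * (1 / w) := by
    rw [mul_one_div, div_le_div_iff₀ (by positivity) hw0]
    rcases le_total p n with hpn | hpn
    · rw [min_eq_left hpn]
      gcongr
      linarith
    · rw [min_eq_right hpn, max_eq_right hn', max_eq_right (by linarith)]
      nlinarith
  calc (c / (4 * Real.exp 1 * Real.pi) * max 1 (min p n) * v ^ 2) ^ (p / 2)
      = ((n / (2 * Real.exp 1 * Real.pi) * v ^ 2) * (c * (max 1 (min p n) / (2 * n)))) ^ (p / 2) := by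
        congr 1
        field_simp
        ring
    _ ≤ (R ^ 2 * (c * (max 1 p * (1 / w)))) ^ (p / 2) := by gcongr
    _ = (R ^ 2) ^ (p / 2) * ((c * max 1 p) ^ (p / 2) * (1 / w) ^ (p / 2)) := by
        rw [← mul_assoc c, Real.mul_rpow (by positivity) (by positivity),
          Real.mul_rpow (y := 1 / w) (by positivity) (by positivity)]
    _ ≤ _ := by gcongr

end

/-! ### Isotropic data and radial functions of convex bodies. -/

theorem zero_mem_interior_of_symmetric {V : Type*} [AddCommGroup V] [Module ℝ V]
    [TopologicalSpace V] [IsTopologicalAddGroup V] [ContinuousConstSMul ℝ V] {K : Set V}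
    (hc : Convex ℝ K) (hs : ∀ x ∈ K, -x ∈ K) (hi : (interior K).Nonempty) : 0 ∈ interior K := by
  obtain ⟨x, hx⟩ := hi
  have := hc.combo_interior_self_mem_interior hx (hs x (interior_subset hx)) (a := 1 / 2)
    (b := 1 / 2) (by norm_num) (by norm_num) (by norm_num)
  simpa using this

theorem hasIsotropicConstant_of_volume {n : ℕ} {K : Set (E n)} {σ v : ℝ} (hσ : 0 ≤ σ) (hv : 0 < v)
    (hV : volume K = ENNReal.ofReal (v ^ (n : ℝ)))
    (h2 : ∀ θ ∈ sphere (0 : E n) 1, ∫ x in K, (inner ℝ x θ) ^ 2 = v ^ (n : ℝ) * σ ^ 2) :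
    HasIsotropicConstant K (σ / v) := by
  refine ⟨by positivity, LinearEquiv.smulOfNeZero ℝ (E n) v⁻¹ (by positivity), ?_, ?_⟩
  all_goals
    have himg : (LinearEquiv.smulOfNeZero ℝ (E n) v⁻¹ (by positivity)) '' K =
        (fun x : E n => v⁻¹ • x) '' K := rfl
    rw [himg, Set.image_smul]
  · rw [Measure.addHaar_smul, hV, ← ENNReal.ofReal_mul (by positivity), Real.rpow_natCast,
      abs_of_pos (by positivity)]
    simp [hv.ne']
  · intro θ hθ
    have h := Measure.setIntegral_comp_smul_of_pos (volume : Measure (E n))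
      (fun x : E n => (inner ℝ x θ) ^ 2) K (R := v⁻¹) (by positivity)
    simp only [real_inner_smul_left, mul_pow, integral_const_mul, h2 θ hθ, finrank_euclideanSpace,
      Fintype.card_fin, smul_eq_mul, Real.rpow_natCast, inv_pow, inv_inv] at h
    refine (mul_left_cancel₀ (pow_ne_zero n hv.ne') (Eq.trans ?_ h)).symm
    field_simp

theorem exists_isotropic_data {n : ℕ} (hn : 1 ≤ n) {K : Set (E n)} (hK : IsCompact K)
    (hc : Convex ℝ K) (hs : ∀ x ∈ K, -x ∈ K) (hi : (interior K).Nonempty)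
    (hiso : IsotropicPosition K) :
    ∃ (v : ℝ) (σ : ℝ≥0), 0 < v ∧ 0 < σ ∧ volume K = ENNReal.ofReal (v ^ (n : ℝ)) ∧
      (∀ θ : E n, ‖θ‖ = 1 → ∫⁻ x in K, ‖inner ℝ x θ‖ₑ ^ 2 = volume K * σ ^ 2) ∧
      isotropicConstant K = σ / v := by
  obtain ⟨m, rfl⟩ : ∃ m, n = m + 1 := ⟨n - 1, by omega⟩
  obtain ⟨c, hcθ⟩ := hiso
  have h0 : volume K ≠ 0 := (Measure.measure_pos_of_nonempty_interior _ hi).ne'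
  have h1 : volume K ≠ ⊤ := hK.measure_ne_top
  set V := (volume K).toReal with hVdef
  have hVpos : 0 < V := ENNReal.toReal_pos h0 h1
  set v := V ^ (1 / ((m + 1 : ℕ) : ℝ)) with hv
  have hvpos : 0 < v := by positivity
  have hvV : v ^ ((m + 1 : ℕ) : ℝ) = V := by
    rw [hv, ← Real.rpow_mul hVpos.le, one_div_mul_cancel (by positivity), Real.rpow_one]
  have hvol : volume K = ENNReal.ofReal (v ^ ((m + 1 : ℕ) : ℝ)) := by
    rw [hvV, hVdef, ENNReal.ofReal_toReal h1]
  have hlin : ∀ θ : E (m + 1), ‖θ‖ = 1 → ∫⁻ x in K, ‖inner ℝ x θ‖ₑ ^ 2 = ENNReal.ofReal c := by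
    intro θ hθ
    rw [← hcθ θ (by simpa using hθ), ofReal_integral_eq_lintegral_ofReal
      ((Continuous.continuousOn (by fun_prop)).integrableOn_compact hK)
      (Filter.Eventually.of_forall fun x => sq_nonneg _)]
    refine lintegral_congr fun x => ?_
    rw [Real.enorm_eq_ofReal_abs, ← ENNReal.ofReal_pow (abs_nonneg _), sq_abs]
  set e : E (m + 1) := EuclideanSpace.single 0 1 with he
  have he1 : ‖e‖ = 1 := by simp [he]
  -- If the second moment vanished, the maximum bound with `σ = 0` would put `K` inside a
  -- hyperplane, against its positive volume.
  have hcpos : 0 < c := by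
    by_contra hneg
    have hz := hlin e he1
    rw [ENNReal.ofReal_of_nonpos (not_lt.1 hneg)] at hz
    have hne : e ≠ 0 := by
      intro h
      rw [h] at he1
      simp at he1
    refine h0 (measure_mono_null (fun x hx => ?_) (volume_hyperplane hne))
    have := inner_le_of_lintegral_sq hn hK.measurableSet hc hs h0 h1 hne (σ := 0)
      (by rw [hz]; simp) hx
    simpa using this
  set σ : ℝ≥0 := Real.toNNReal (√(c / V)) with hσ
  have hσR : (σ : ℝ) = √(c / V) := Real.coe_toNNReal _ (Real.sqrt_nonneg _)
  have hσ2 : V * (σ : ℝ) ^ 2 = c := by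
    rw [hσR, Real.sq_sqrt (by positivity)]
    field_simp
  have hσpos : 0 < σ := by
    rw [← NNReal.coe_pos, hσR]
    positivity
  refine ⟨v, σ, hvpos, hσpos, hvol, fun θ hθ => ?_, ?_⟩
  · rw [hlin θ hθ, ← hσ2, ENNReal.ofReal_mul hVpos.le, hVdef, ENNReal.ofReal_toReal h1,
      ENNReal.ofReal_pow NNReal.zero_le_coe, ENNReal.ofReal_coe_nnreal]
  · refine HasIsotropicConstant.isotropicConstant_eq hn (hasIsotropicConstant_of_volume σ.2 hvpos hvol
      fun θ hθ => ?_)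
    rw [hcθ θ hθ, hvV, hσ2]

theorem smul_mem_iff_le_inv_gauge {n : ℕ} {K : Set (E n)} (hK : IsCompact K) (hc : Convex ℝ K)
    (h0 : (0 : E n) ∈ interior K) {u : E n} (hu : u ≠ 0) {r : ℝ} (hr : 0 ≤ r) :
    r • u ∈ K ↔ r ≤ (gauge K u)⁻¹ := by
  have hn : K ∈ nhds (0 : E n) := mem_interior_iff_mem_nhds.1 h0
  have hg : 0 < gauge K u := (gauge_pos (absorbent_nhds_zero hn)
    (NormedSpace.isVonNBounded_of_isBounded ℝ hK.isBounded)).2 hu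
  rw [← hK.isClosed.closure_eq, ← gauge_le_one_iff_mem_closure hc hn, gauge_smul_of_nonneg hr,
    hK.isClosed.closure_eq, smul_eq_mul, ← le_div_iff₀ hg, one_div]

theorem radial_eq_inv_gauge {n : ℕ} {K : Set (E n)} (hK : IsCompact K) (hc : Convex ℝ K)
    (h0 : (0 : E n) ∈ interior K) {u : E n} (hu : u ≠ 0) : radial K u = (gauge K u)⁻¹ := by
  have : {r : ℝ | 0 ≤ r ∧ r • u ∈ K} = Set.Icc 0 (gauge K u)⁻¹ := by
    ext r
    exact and_congr_right fun hr => smul_mem_iff_le_inv_gauge hK hc h0 hu hr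
  rw [radial, this, csSup_Icc (inv_nonneg.2 (gauge_nonneg _))]

/-! ### Subspaces of `L_p` and dual mixed volumes. -/

theorem Lp_coeFn_finset_sum {α ι F : Type*} [MeasurableSpace α] {μ : Measure α}
    [NormedAddCommGroup F] {p : ℝ≥0∞} (s : Finset ι) (f : ι → Lp F p μ) :
    ⇑(∑ i ∈ s, f i) =ᵐ[μ] fun t => ∑ i ∈ s, f i t := by
  classical
  induction s using Finset.induction_on with
  | empty =>
    filter_upwards [Lp.coeFn_zero F p μ] with t ht
    simpa using ht
  | insert a s ha ih =>
    rw [Finset.sum_insert ha]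
    filter_upwards [Lp.coeFn_add (f a) (∑ i ∈ s, f i), ih] with t h1 h2
    rw [h1, Pi.add_apply, h2, Finset.sum_insert ha]

/-- The values at `t` of the functions `T e₁, …, T eₙ`, as a vector of `ℝⁿ`. -/
noncomputable def symbol {n : ℕ} {p : ℝ} (T : E n →ₗ[ℝ] LpUnit p) (t : ℝ) : E n :=
  WithLp.toLp 2 fun i => T (EuclideanSpace.single i 1) t

section
variable {n : ℕ} {p : ℝ} (T : E n →ₗ[ℝ] LpUnit p)

theorem measurable_symbol : Measurable (symbol T) := by
  have h : Measurable fun t => fun i : Fin n => T (EuclideanSpace.single i 1) t :=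
    measurable_pi_lambda _ fun i => (Lp.stronglyMeasurable _).measurable
  exact (PiLp.volume_preserving_toLp (Fin n)).measurable.comp h

/-- The exceptional null set depends on `x`. Replacing `T x` by the right-hand side gives a kernel
jointly measurable in `(x, t)`, to which Tonelli applies. -/
theorem coeFn_eq_inner_symbol (x : E n) :
    ⇑(T x) =ᵐ[volume.restrict (Set.Icc (0 : ℝ) 1)] fun t => inner ℝ x (symbol T t) := by
  have hx : T x = ∑ i, x i • T (EuclideanSpace.single i 1) := by
    conv_lhs => rw [← (EuclideanSpace.basisFun (Fin n) ℝ).sum_repr x]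
    simp [map_sum]
  have h2 : ∀ᵐ t ∂volume.restrict (Set.Icc (0 : ℝ) 1), ∀ i : Fin n,
      (x i • T (EuclideanSpace.single i 1) : LpUnit p) t = x i * T (EuclideanSpace.single i 1) t := by
    rw [ae_all_iff]
    intro i
    filter_upwards [Lp.coeFn_smul (x i) (T (EuclideanSpace.single i 1))] with t ht
    simpa using ht
  rw [hx]
  filter_upwards [Lp_coeFn_finset_sum Finset.univ fun i => x i • T (EuclideanSpace.single i 1), h2]
    with t h1 h2
  rw [h1, PiLp.inner_apply]
  refine Finset.sum_congr rfl fun i _ => ?_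
  rw [h2 i]
  simp [symbol, mul_comm]

/-- The `p`-th power of the `L_p` quasi-norm of `T x`. -/
noncomputable def powNorm (x : E n) : ℝ≥0∞ :=
  ∫⁻ t in Set.Icc (0 : ℝ) 1, ‖inner ℝ x (symbol T t)‖ₑ ^ p

theorem measurable_powNorm : Measurable (powNorm T) := by
  have := measurable_symbol T
  refine Measurable.lintegral_prod_right' (f := fun q : E n × ℝ => ‖inner ℝ q.1 (symbol T q.2)‖ₑ ^ p) ?_
  fun_prop

variable {T}

theorem eLpNorm_eq_powNorm (hp : 0 < p) (x : E n) :
    eLpNorm (T x) (ENNReal.ofReal p) (volume.restrict (Set.Icc (0 : ℝ) 1)) = powNorm T x ^ (1 / p) := by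
  rw [eLpNorm_congr_ae (coeFn_eq_inner_symbol T x), eLpNorm_eq_lintegral_rpow_enorm_toReal
    (by simpa using hp) ENNReal.ofReal_ne_top, ENNReal.toReal_ofReal hp.le]
  rfl

theorem powNorm_ne_top (hp : 0 < p) (x : E n) : powNorm T x ≠ ⊤ := by
  have h := (Lp.eLpNorm_lt_top (T x)).ne
  rw [eLpNorm_eq_powNorm hp] at h
  intro h'
  rw [h', ENNReal.top_rpow_of_pos (by positivity)] at h
  exact h rfl

theorem norm_eq_powNorm (hp : 0 < p) (x : E n) : ‖T x‖ = (powNorm T x).toReal ^ (1 / p) := by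
  rw [Lp.norm_def, eLpNorm_eq_powNorm hp, ENNReal.toReal_rpow]

theorem powNorm_ne_zero (hp : 0 < p) (hT : Function.Injective T) {x : E n} (hx : x ≠ 0) :
    powNorm T x ≠ 0 := by
  intro h
  have h1 := norm_eq_powNorm (T := T) hp x
  rw [h, ENNReal.toReal_zero, Real.zero_rpow (by positivity),
    Lp.norm_eq_zero_iff (by simpa using hp)] at h1
  exact hx (hT (by rw [h1, map_zero]))

theorem powNorm_smul (hp : 0 < p) (r : ℝ) (hr : 0 < r) (x : E n) :
    powNorm T (r • x) = ENNReal.ofReal r ^ p * powNorm T x := by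
  have := measurable_symbol T
  simp only [powNorm]
  rw [← lintegral_const_mul _ (by fun_prop)]
  exact lintegral_congr fun t => enorm_inner_smul_rpow hp.le _ _ hr _

theorem radial_rpow_eq_powNorm (hp : 0 < p) (hT : Function.Injective T) {u : E n} (hu : u ≠ 0) :
    radial {x | ‖T x‖ ≤ 1} u ^ (-p) = (powNorm T u).toReal := by
  have hN : 0 < (powNorm T u).toReal := ENNReal.toReal_pos (powNorm_ne_zero hp hT hu) (powNorm_ne_top hp u)
  have hset : {r : ℝ | 0 ≤ r ∧ r • u ∈ {x | ‖T x‖ ≤ 1}} =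
      Set.Icc 0 ((powNorm T u).toReal ^ (-(1 / p))) := by
    ext r
    refine and_congr_right fun hr => ?_
    rcases hr.eq_or_lt with rfl | hr
    · simp only [zero_smul, Set.mem_ofPred_eq, map_zero]
      refine iff_of_true ?_ (by positivity)
      rw [(Lp.norm_eq_zero_iff (by simpa using hp)).2 rfl]
      exact zero_le_one
    · rw [Set.mem_ofPred_eq, norm_eq_powNorm hp, powNorm_smul hp _ hr, ENNReal.toReal_mul,
        ← ENNReal.toReal_rpow, ENNReal.toReal_ofReal hr.le,
        Real.mul_rpow (by positivity) hN.le, ← Real.rpow_mul hr.le, mul_one_div_cancel hp.ne',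
        Real.rpow_one, Real.rpow_neg hN.le, ← le_div_iff₀ (by positivity), one_div]
  rw [radial, hset, csSup_Icc (by positivity), ← Real.rpow_mul hN.le]
  rw [show -(1 / p) * -p = 1 by field_simp, Real.rpow_one]

theorem lintegral_powNorm (K : Set (E n)) :
    ∫⁻ x in K, powNorm T x =
      ∫⁻ t in Set.Icc (0 : ℝ) 1, ∫⁻ x in K, ‖inner ℝ x (symbol T t)‖ₑ ^ p := by
  have := measurable_symbol T
  exact lintegral_lintegral_swap (f := fun (x : E n) (t : ℝ) => ‖inner ℝ x (symbol T t)‖ₑ ^ p)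
    (by fun_prop)

/-- The exponent `n - (-p) = n + p` of `ρ_K` is exactly what radial integration of `r^{n-1} · r^p`
produces. The prefactor does not depend on the body. -/
theorem dualMixedVolume_eq (hn : 1 ≤ n) (hp : 0 < p) (hT : Function.Injective T) {K : Set (E n)}
    (hK : IsCompact K) (hc : Convex ℝ K) (h0 : (0 : E n) ∈ interior K) :
    dualMixedVolume (-p) {x | ‖T x‖ ≤ 1} K = (n + p) / n * (∫⁻ x in K, powNorm T x).toReal := by
  have hn' : (0 : ℝ) < n := by exact_mod_cast hn
  have hu0 : ∀ u : sphere (0 : E n) 1, (u : E n) ≠ 0 := fun u => ne_zero_of_mem_unit_sphere u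
  have hgauge : Continuous (gauge K) := continuous_gauge hc (mem_interior_iff_mem_nhds.1 h0)
  have hmN := measurable_powNorm T
  have hpoint : ∀ u : sphere (0 : E n) 1,
      radial {x | ‖T x‖ ≤ 1} (u : E n) ^ (-p) * radial K (u : E n) ^ ((n : ℝ) - -p) =
        (powNorm T u).toReal * (gauge K u)⁻¹ ^ ((n : ℝ) + p) := by
    intro u
    rw [radial_rpow_eq_powNorm hp hT (hu0 u), radial_eq_inv_gauge hK hc h0 (hu0 u), sub_neg_eq_add]
  have hg : ∀ u : E n, 0 ≤ (gauge K u)⁻¹ := fun u => inv_nonneg.2 (gauge_nonneg _)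
  rw [dualMixedVolume]
  simp_rw [hpoint]
  have hmeas : Measurable fun u : sphere (0 : E n) 1 =>
      (powNorm T (u : E n)).toReal * (gauge K u)⁻¹ ^ ((n : ℝ) + p) := by fun_prop
  rw [integral_eq_lintegral_of_nonneg_ae (Filter.Eventually.of_forall
      fun u : sphere (0 : E n) 1 => mul_nonneg ENNReal.toReal_nonneg (Real.rpow_nonneg (hg u) _))
    hmeas.aestronglyMeasurable,
    lintegral_homogeneous_body hn hp.le hmN (powNorm_smul hp) hK.measurableSet
      (ρ := fun u => (gauge K u)⁻¹) hg (fun u hu r hr =>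
        smul_mem_iff_le_inv_gauge hK hc h0 (ne_zero_of_mem_unit_sphere ⟨u, hu⟩) hr.le)]
  have e : ∀ u : sphere (0 : E n) 1,
      ENNReal.ofReal ((powNorm T u).toReal * (gauge K u)⁻¹ ^ ((n : ℝ) + p)) =
        ENNReal.ofReal (n + p) *
          (powNorm T u * ENNReal.ofReal ((gauge K u)⁻¹ ^ ((n : ℝ) + p) / (n + p))) := by
    intro u
    rw [ENNReal.ofReal_mul ENNReal.toReal_nonneg, ENNReal.ofReal_toReal (powNorm_ne_top hp _),
      mul_left_comm, ← ENNReal.ofReal_mul (by positivity)]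
    congr 2
    field_simp
  rw [lintegral_congr e, lintegral_const_mul _ (by fun_prop), ENNReal.toReal_mul,
    ENNReal.toReal_ofReal (by positivity)]
  ring

/-- This integral is the common factor of the estimates for `K` and for the ball, so it must be
nonzero and finite to cancel. If it vanished, `symbol T` would be zero almost everywhere and `T`
would not be injective. -/
theorem lintegral_symbol_ne_zero (hn : 1 ≤ n) (hp : 0 < p) (hT : Function.Injective T) :
    ∫⁻ t in Set.Icc (0 : ℝ) 1, ‖symbol T t‖ₑ ^ p ≠ 0 := by
  obtain ⟨m, rfl⟩ : ∃ m, n = m + 1 := ⟨n - 1, by omega⟩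
  have hm := measurable_symbol T
  intro h
  rw [lintegral_eq_zero_iff (by fun_prop)] at h
  refine powNorm_ne_zero hp hT (x := EuclideanSpace.single (0 : Fin (m + 1)) 1) (by simp) ?_
  rw [powNorm, lintegral_eq_zero_iff (by fun_prop)]
  filter_upwards [h] with t ht
  have : symbol T t = 0 := by simpa [hp, hp.le, hp.not_gt] using ht
  simp [this, hp]

theorem lintegral_symbol_ne_top (hp : 0 < p) :
    ∫⁻ t in Set.Icc (0 : ℝ) 1, ‖symbol T t‖ₑ ^ p ≠ ⊤ := by
  have h : MemLp (symbol T) (ENNReal.ofReal p) (volume.restrict (Set.Icc (0 : ℝ) 1)) :=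
    MemLp.of_eval_piLp fun i => Lp.memLp (T (EuclideanSpace.single i 1))
  have := lintegral_rpow_enorm_lt_top_of_eLpNorm_lt_top (by simpa using hp) ENNReal.ofReal_ne_top
    h.eLpNorm_lt_top
  rw [ENNReal.toReal_ofReal hp.le] at this
  exact this.ne

theorem lintegral_inner_eq_normalize (hp : 0 ≤ p) (K : Set (E n)) {w : E n} (hw : w ≠ 0) :
    ∫⁻ x in K, ‖inner ℝ x w‖ₑ ^ p =
      (∫⁻ x in K, ‖inner ℝ x (‖w‖⁻¹ • w)‖ₑ ^ p) * ‖w‖ₑ ^ p := by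
  rw [← lintegral_mul_const _ (by fun_prop)]
  refine lintegral_congr fun x => ?_
  rw [← ENNReal.mul_rpow_of_nonneg _ _ hp, ← enorm_norm w, ← enorm_mul, real_inner_smul_right]
  congr 2
  have := norm_ne_zero_iff.2 hw
  field_simp

theorem norm_normalize {w : E n} (hw : w ≠ 0) : ‖‖w‖⁻¹ • w‖ = 1 := by
  rw [norm_smul, norm_inv, norm_norm, inv_mul_cancel₀ (norm_ne_zero_iff.2 hw)]

/-- A bound for `∫_K |⟨x, θ⟩|^p dx` that is uniform over unit vectors `θ` integrates to a bound for
`∫_K ‖T x‖^p dx`. -/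
theorem lintegral_powNorm_le (hp : 0 < p) {K : Set (E n)} {M : ℝ≥0∞}
    (hM : ∀ θ : E n, ‖θ‖ = 1 → ∫⁻ x in K, ‖inner ℝ x θ‖ₑ ^ p ≤ M) :
    ∫⁻ x in K, powNorm T x ≤ M * ∫⁻ t in Set.Icc (0 : ℝ) 1, ‖symbol T t‖ₑ ^ p := by
  have hm := measurable_symbol T
  rw [lintegral_powNorm, ← lintegral_const_mul _ (by fun_prop)]
  refine lintegral_mono fun t => ?_
  rcases eq_or_ne (symbol T t) 0 with h | h
  · simp [h, hp]
  · rw [lintegral_inner_eq_normalize hp.le K h]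
    gcongr
    exact hM _ (norm_normalize h)

theorem le_lintegral_powNorm (hp : 0 < p) {K : Set (E n)} {M : ℝ≥0∞}
    (hM : ∀ θ : E n, ‖θ‖ = 1 → M ≤ ∫⁻ x in K, ‖inner ℝ x θ‖ₑ ^ p) :
    M * ∫⁻ t in Set.Icc (0 : ℝ) 1, ‖symbol T t‖ₑ ^ p ≤ ∫⁻ x in K, powNorm T x := by
  have hm := measurable_symbol T
  rw [lintegral_powNorm, ← lintegral_const_mul _ (by fun_prop)]
  refine lintegral_mono fun t => ?_
  rcases eq_or_ne (symbol T t) 0 with h | h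
  · simp [h, hp]
  · rw [lintegral_inner_eq_normalize hp.le K h]
    gcongr
    exact hM _ (norm_normalize h)

end

end DualMixed

/-! ### Assembly of the two-sided estimate. -/

open DualMixed
theorem mainTheorem6 :
    ∃ C₁ C₂ : ℝ, 0 < C₁ ∧ 0 < C₂ ∧
      ∀ (n : ℕ), 1 ≤ n →
      ∀ (K : ConvexBody (E n)), (interior (K : Set (E n))).Nonempty →
        (∀ x ∈ K, -x ∈ K) → IsotropicPosition (K : Set (E n)) →
      ∀ (R : ℝ), volume (closedBall (0 : E n) R) = volume (K : Set (E n)) →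
      ∀ (p : ℝ), 0 < p → ∀ L ∈ SL p n,
        C₁ / √(max 1 (min p n)) ≤
            isotropicConstant (K : Set (E n)) /
              (dualMixedVolume (-p) L K /
                dualMixedVolume (-p) L (closedBall (0 : E n) R)) ^ (1 / p) ∧
          isotropicConstant (K : Set (E n)) /
              (dualMixedVolume (-p) L K /
                dualMixedVolume (-p) L (closedBall (0 : E n) R)) ^ (1 / p) ≤
            C₂ * √(max 1 (min p n)) := by
  obtain ⟨c, hc, hball⟩ := exists_le_lintegral_inner_closedBall
  refine ⟨c / 16, 289, by positivity, by norm_num, ?_⟩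
  rintro n hn K hi hs hiso R hR p hp _ ⟨T, hT, rfl⟩
  have hn' : (0 : ℝ) < n := by exact_mod_cast hn
  have : Nonempty (Fin n) := ⟨⟨0, hn⟩⟩
  obtain ⟨v, σ, hv, hσ, hvol, hsq, hL⟩ := exists_isotropic_data hn K.isCompact K.convex hs hi hiso
  have hV0 : volume (K : Set (E n)) ≠ 0 := (Measure.measure_pos_of_nonempty_interior _ hi).ne'
  have hV1 : volume (K : Set (E n)) ≠ ⊤ := K.isCompact.measure_ne_top
  have hRpos : 0 < R := by
    by_contra hneg
    refine hV0 (hR ▸ ?_)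
    refine measure_mono_null (closedBall_subset_closedBall (not_lt.1 hneg)) ?_
    simp
  have h0K := zero_mem_interior_of_symmetric K.convex hs hi
  have h0B : (0 : E n) ∈ interior (closedBall (0 : E n) R) :=
    mem_interior_iff_mem_nhds.2 (closedBall_mem_nhds _ hRpos)
  have hvolB := hR.trans hvol
  set P : ℝ := max 1 (min p n) with hP
  have hP1 : 1 ≤ P := le_max_left _ _
  have hP0 : 0 < P := by linarith
  have hne : ∀ θ : E n, ‖θ‖ = 1 → θ ≠ 0 := fun θ h => norm_ne_zero_iff.1 (by rw [h]; exact one_ne_zero)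
  set Q := ∫⁻ t in Set.Icc (0 : ℝ) 1, ‖symbol T t‖ₑ ^ p with hQ
  have hQ0 : 0 < Q.toReal := ENNReal.toReal_pos (lintegral_symbol_ne_zero hn hp hT)
    (lintegral_symbol_ne_top hp)
  set V := volume (K : Set (E n)) with hV
  have hVpos : 0 < V.toReal := ENNReal.toReal_pos hV0 hV1
  have hσp : ((σ : ENNReal) ^ p) = ENNReal.ofReal ((σ : ℝ) ^ p) := by
    rw [← ENNReal.ofReal_rpow_of_nonneg NNReal.zero_le_coe hp.le, ENNReal.ofReal_coe_nnreal]
  -- `up` and `low` turn a bound `V a^p` on the moments of all unit functionals over `B` into the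
  -- bound `V a^p Q` on `∫_B ‖T x‖^p`. Finiteness is recorded because `low` needs it to pass to
  -- reals.
  have up : ∀ (B : Set (E n)) (a : ℝ), 0 ≤ a → (∀ θ : E n, ‖θ‖ = 1 →
      ∫⁻ x in B, ‖inner ℝ x θ‖ₑ ^ p ≤ V * ENNReal.ofReal (a ^ p)) →
      ∫⁻ x in B, powNorm T x ≠ ⊤ ∧
      (∫⁻ x in B, powNorm T x).toReal ≤ V.toReal * a ^ p * Q.toReal := by
    intro B a ha h
    have h1 := lintegral_powNorm_le (T := T) hp h
    have h2 : V * ENNReal.ofReal (a ^ p) * Q ≠ ⊤ := ENNReal.mul_ne_top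
      (ENNReal.mul_ne_top hV1 ENNReal.ofReal_ne_top) (lintegral_symbol_ne_top hp)
    refine ⟨(h1.trans_lt h2.lt_top).ne, ?_⟩
    have h3 := ENNReal.toReal_mono h2 h1
    rwa [ENNReal.toReal_mul, ENNReal.toReal_mul, ENNReal.toReal_ofReal (by positivity)] at h3
  have low : ∀ (B : Set (E n)) (a : ℝ), 0 ≤ a → ∫⁻ x in B, powNorm T x ≠ ⊤ →
      (∀ θ : E n, ‖θ‖ = 1 → V * ENNReal.ofReal (a ^ p) ≤ ∫⁻ x in B, ‖inner ℝ x θ‖ₑ ^ p) →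
      V.toReal * a ^ p * Q.toReal ≤ (∫⁻ x in B, powNorm T x).toReal := by
    intro B a ha ht h
    have h3 := ENNReal.toReal_mono ht (le_lintegral_powNorm (T := T) hp h)
    rwa [ENNReal.toReal_mul, ENNReal.toReal_mul, ENNReal.toReal_ofReal (by positivity)] at h3
  obtain ⟨tK, uK⟩ := up K (16 * P * σ) (by positivity) fun θ hθ => by
    refine (lintegral_inner_le hn K.isCompact.measurableSet K.convex hs hV0 hV1 (hne θ hθ) hσ
      (hsq θ hθ) hp).trans_eq ?_
    rw [hσp, mul_assoc, ← ENNReal.ofReal_mul (by positivity), ← hP, mul_comm ((σ : ℝ) ^ p),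
      ← Real.mul_rpow (by positivity) (by positivity)]
  obtain ⟨tB, uB⟩ := up (closedBall 0 R) (√P * v) (by positivity) fun θ hθ => by
    have h := lintegral_inner_closedBall_le hn hRpos hv hvolB hp hθ
    rwa [hR] at h
  have lK := low K (σ / 289) (by positivity) tK fun θ hθ => by
    have h := le_lintegral_inner K.isCompact.measurableSet K.convex hs hV0 hV1 (hne θ hθ) hσ
      (hsq θ hθ) hp
    have e : (289 : ENNReal) ^ p = ENNReal.ofReal (289 ^ p) := by
      rw [← ENNReal.ofReal_rpow_of_nonneg (by norm_num) hp.le]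
      norm_num
    rw [hσp, e] at h
    rw [Real.div_rpow (by positivity) (by norm_num), ENNReal.ofReal_div_of_pos (by positivity),
      ← mul_div_assoc]
    exact ENNReal.div_le_of_le_mul' h
  have lB := low (closedBall 0 R) (c * √P * v) (by positivity) tB fun θ hθ => by
    have h := hball n hn R hRpos v hv hvolB p hp θ hθ
    rwa [hR] at h
  rw [dualMixedVolume_eq hn hp hT K.isCompact K.convex h0K,
    dualMixedVolume_eq hn hp hT (isCompact_closedBall _ _) (convex_closedBall _ _) h0B,
    mul_div_mul_left _ _ (by positivity), hL]
  set X := (∫⁻ x in K, powNorm T x).toReal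
  set Y := (∫⁻ x in closedBall 0 R, powNorm T x).toReal
  have hσR : (0 : ℝ) < σ := hσ
  have hX : 0 < X := lt_of_lt_of_le (by positivity) lK
  have hY : 0 < Y := lt_of_lt_of_le (by positivity) lB
  have hsP : 0 < √P := by positivity
  -- Quotient of the upper mean `16 P σ` on `K` by the lower mean `c √P v` on the ball; `r2` divides
  -- `σ / 289` by `√P v`.
  have r1 : (X / Y) ^ (1 / p) ≤ 16 * √P * σ / (c * v) := by
    rw [one_div, Real.rpow_inv_le_iff_of_pos (by positivity) (by positivity) hp, div_le_iff₀ hY]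
    calc X ≤ V.toReal * (16 * P * σ) ^ p * Q.toReal := uK
      _ = (16 * √P * σ / (c * v)) ^ p * (V.toReal * (c * √P * v) ^ p * Q.toReal) := by
        rw [show 16 * P * (σ : ℝ) = 16 * √P * σ / (c * v) * (c * √P * v) by
          nth_rw 1 [← Real.mul_self_sqrt hP0.le]
          field_simp, Real.mul_rpow (by positivity) (by positivity)]
        ring
      _ ≤ _ := by gcongr
  have r2 : σ / (289 * √P * v) ≤ (X / Y) ^ (1 / p) := by
    rw [one_div, Real.le_rpow_inv_iff_of_pos (by positivity) (by positivity) hp, le_div_iff₀ hY]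
    calc (σ / (289 * √P * v)) ^ p * Y
        ≤ (σ / (289 * √P * v)) ^ p * (V.toReal * (√P * v) ^ p * Q.toReal) := by gcongr
      _ = V.toReal * (σ / 289) ^ p * Q.toReal := by
        rw [show (σ / 289 : ℝ) = σ / (289 * √P * v) * (√P * v) by field_simp,
          Real.mul_rpow (x := σ / (289 * √P * v)) (by positivity) (by positivity)]
        ring
      _ ≤ X := lK
  have hr : 0 < (X / Y) ^ (1 / p) := by positivity
  constructor
  · rw [le_div_iff₀ hr]
    calc c / 16 / √P * (X / Y) ^ (1 / p) ≤ c / 16 / √P * (16 * √P * σ / (c * v)) := by gcongr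
      _ = σ / v := by field_simp
  · rw [div_le_iff₀ hr]
    calc σ / v = 289 * √P * (σ / (289 * √P * v)) := by field_simp
      _ ≤ _ := by gcongr
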